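/- Let $p\in\mathbb R^n$ and $q\in\mathbb R^m$ be probability vectors. For a vector $r$ with finitely many nonzero, nonnegative entries, padded with zeros to an infinite sequence, and for $0\le x\le 1$ put $\beta_x(r,1_\infty)=\inf\{\sum_i t_i : 0\le t_i\le 1,\ \sum_i t_i r_i\ge x\}$. For $N\ge 1$ let $w_N=(1/N,\dots,1/N)\in\mathbb R^N$. Write $a\succeq b$ if, after padding both vectors with zeros to a common length, $b$ is the image of $a$ under a doubly stochastic matrix. Then the maximum $$z^\star=\max_{x\in(0,1]}\frac{\beta_x(p,1_\infty)}{\beta_x(q,1_\infty)}$$ exists, $0<z^\star<\infty$, and $z^\star$ is the optimal cost parameter of the battery-assisted transformation $|\psi_q\rangle\to|\psi_p\rangle$, in each of the following three equivalent senses: (1) $z^\star=\inf\{N/N' : N,N'\ge 1,\ p\otimes w_{N'}\succeq q\otimes w_N\}$. (2) (Bipartite entanglement.) Let $|\psi_q\rangle,|\psi_p\rangle$ be any pure bipartite states on finite-dimensional spaces with Schmidt coefficients $q$ and $p$, i.e. $|\psi_q\rangle=\sum_j\sqrt{q_j}\,|\xi_j\rangle\otimes|\eta_j\rangle$ with orthonormal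 families $(\xi_j)$, $(\eta_j)$, and likewise for $p$, and let $|\phi_N\rangle=N^{-1/2}\sum_{j=1}^N|j\rangle\otimes|j\rangle$. Then $z^\star$ is the infimum of $N/N'$ over all $N,N'\ge1$ for which some operation consisting of finitely many rounds of local operations and classical communication (LOCC) maps $|\psi_q\rangle\otimes|\phi_N\rangle$ to $|\psi_p\rangle\otimes|\phi_{N'}\rangle$. (3) (Coherence.) Let $|\psi_q\rangle\in\mathbb C^m$ and $|\psi_p\rangle\in\mathbb C^n$ be any vectors whose squared amplitudes in the standard basis are $q$ and $p$, and let $|\phi_N\rangle=N^{-1/2}\sum_{j=1}^N|j\rangle$. Then $z^\star$ is the infimum of $N/N'$ over all $N,N'\ge1$ for which some strictly incoherent operation (all Kraus operators of the form $\sum_j c(j)|f(j)\rangle\langle j|$ with $f$ one-to-one on $\{j:c(j)\neq0\}$) maps $|\psi_q\rangle\otimes|\phi_N\rangle$ to $|\psi_p\rangle\otimes|\phi_{N'}\rangle$. In each case the transformation with battery sizes $N,N'$ is possible if and only if $N/N'\ge z^\star$; in particular the infimum is a minimum whenever $z^\star$ is rational. -/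

import Mathlib

open scoped ENNReal Kronecker BigOperators

noncomputable section

/-! ### Lorenz curves -/

/-- `betaCurve x p r` is the least value of `t · r` over all tests `0 ≤ t ≤ 1` with `t · p ≥ x`.
It is `0` for `x ≤ 0` and `∞` if no test is feasible. All sums are sums of extended nonnegative
numbers, so they always exist. -/
def betaCurve {ι : Type*} (x : ℝ) (p r : ι → ℝ≥0∞) : ℝ≥0∞ :=
  ⨅ (t : ι → ℝ≥0∞) (_ : ∀ i, t i ≤ 1) (_ : ENNReal.ofReal x ≤ ∑' i, t i * p i), ∑' i, t i * r i

/-- A finite vector with nonnegative entries, embedded in the countably infinite dimensional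
space of sequences by padding with zeros. -/
def padSeq {n : ℕ} (p : Fin n → ℝ) : ℕ → ℝ≥0∞ :=
  fun j => if h : j < n then ENNReal.ofReal (p ⟨j, h⟩) else 0

/-- The all-ones sequence. -/
def onesSeq : ℕ → ℝ≥0∞ := fun _ => 1

/-! ### Majorization -/

/-- `Majorizes p q`: after padding both vectors with zeros to a common length `d`, the vector `q`
is the image of `p` under a doubly stochastic matrix. -/
def Majorizes {ι κ : Type*} (p : ι → ℝ) (q : κ → ℝ) : Prop :=
  ∃ (d : ℕ) (e : ι ↪ Fin d) (f : κ ↪ Fin d) (M : Matrix (Fin d) (Fin d) ℝ),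
    M ∈ doublyStochastic ℝ (Fin d) ∧
      M.mulVec (Function.extend e p 0) = Function.extend f q 0

/-- The vector `p ⊗ w_N`, where `w_N` is the uniform distribution on `N` points. -/
def tensorUniform {ι : Type*} (p : ι → ℝ) (N : ℕ) : ι × Fin N → ℝ :=
  fun x => p x.1 * (1 / (N : ℝ))

/-! ### Pure states -/

/-- The rank-one operator `|ψ⟩⟨ψ|`. -/
def ketbra {ι : Type*} (ψ : ι → ℂ) : Matrix ι ι ℂ := Matrix.vecMulVec ψ (star ψ)

/-- The bipartite vector `ψ` is `∑ₖ √(pₖ) ξₖ ⊗ ηₖ` for some orthonormal families `ξ`, `η`,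
i.e. the Schmidt coefficients of `ψ` are `p`. -/
def HasSchmidtCoeffs {α β : Type*} [Fintype α] [Fintype β] {n : ℕ}
    (ψ : α × β → ℂ) (p : Fin n → ℝ) : Prop :=
  ∃ (ξ : Fin n → EuclideanSpace ℂ α) (η : Fin n → EuclideanSpace ℂ β),
    Orthonormal ℂ ξ ∧ Orthonormal ℂ η ∧
      ∀ a b, ψ (a, b) = ∑ k, ((Real.sqrt (p k) : ℝ) : ℂ) * ξ k a * η k b

/-- The maximally entangled state `N^{-1/2} ∑ⱼ |j⟩ ⊗ |j⟩`. -/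
def maxEntangled (N : ℕ) : Fin N × Fin N → ℂ :=
  fun x => if x.1 = x.2 then ((1 / Real.sqrt N : ℝ) : ℂ) else 0

/-- The tensor product of two bipartite states, as a state shared by a party holding both first
subsystems and a party holding both second subsystems. -/
def bipartiteTensor {α β γ δ : Type*} (ψ : α × β → ℂ) (χ : γ × δ → ℂ) :
    (α × γ) × (β × δ) → ℂ :=
  fun x => ψ (x.1.1, x.2.1) * χ (x.1.2, x.2.2)

/-- The maximally coherent state `N^{-1/2} ∑ⱼ |j⟩`. -/
def maxCoherent (N : ℕ) : Fin N → ℂ := fun _ => ((1 / Real.sqrt N : ℝ) : ℂ)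

/-- The tensor product of two vectors. -/
def stateTensor {ι κ : Type*} (ψ : ι → ℂ) (χ : κ → ℂ) : ι × κ → ℂ :=
  fun x => ψ x.1 * χ x.2

/-! ### Local operations and classical communication -/

/-- `IsLOCC E`: the map `E` on operators is realized by a finite protocol of local measurements
and classical communication. In each round one of the parties performs a generalized measurement
with Kraus operators `K i` (whose output space may depend on `i`) on the system held by that party,
the outcome `i` is announced, and the protocol continues in a way that may depend on `i`. At the
end the record of outcomes is forgotten. -/
inductive IsLOCC (α' β' : Type) [Fintype α'] [DecidableEq α'] [Fintype β'] [DecidableEq β'] :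
    ∀ (α β : Type) [Fintype α] [DecidableEq α] [Fintype β] [DecidableEq β],
      (Matrix (α × β) (α × β) ℂ → Matrix (α' × β') (α' × β') ℂ) → Prop
  | finish : IsLOCC α' β' α' β' (fun ρ => ρ)
  | alice {α β : Type} [Fintype α] [DecidableEq α] [Fintype β] [DecidableEq β]
      {k : ℕ} (γ : Fin k → Type) [∀ i, Fintype (γ i)] [∀ i, DecidableEq (γ i)]
      (K : ∀ i, Matrix (γ i) α ℂ) (hK : ∑ i, (K i).conjTranspose * K i = 1)
      (E : ∀ i, Matrix (γ i × β) (γ i × β) ℂ → Matrix (α' × β') (α' × β') ℂ)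
      (hE : ∀ i, IsLOCC α' β' (γ i) β (E i)) :
      IsLOCC α' β' α β (fun ρ => ∑ i,
        E i ((K i ⊗ₖ (1 : Matrix β β ℂ)) * ρ * (K i ⊗ₖ (1 : Matrix β β ℂ)).conjTranspose))
  | bob {α β : Type} [Fintype α] [DecidableEq α] [Fintype β] [DecidableEq β]
      {k : ℕ} (γ : Fin k → Type) [∀ i, Fintype (γ i)] [∀ i, DecidableEq (γ i)]
      (K : ∀ i, Matrix (γ i) β ℂ) (hK : ∑ i, (K i).conjTranspose * K i = 1)
      (E : ∀ i, Matrix (α × γ i) (α × γ i) ℂ → Matrix (α' × β') (α' × β') ℂ)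
      (hE : ∀ i, IsLOCC α' β' α (γ i) (E i)) :
      IsLOCC α' β' α β (fun ρ => ∑ i,
        E i (((1 : Matrix α α ℂ) ⊗ₖ K i) * ρ * ((1 : Matrix α α ℂ) ⊗ₖ K i).conjTranspose))

/-- Some LOCC operation maps the pure state `ψ` to the pure state `φ`. -/
def LOCCTransforms {α β α' β' : Type} [Fintype α] [DecidableEq α] [Fintype β] [DecidableEq β]
    [Fintype α'] [DecidableEq α'] [Fintype β'] [DecidableEq β']
    (ψ : α × β → ℂ) (φ : α' × β' → ℂ) : Prop :=
  ∃ E : Matrix (α × β) (α × β) ℂ → Matrix (α' × β') (α' × β') ℂ,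
    IsLOCC α' β' α β E ∧ E (ketbra ψ) = ketbra φ

/-! ### Strictly incoherent operations -/

/-- A Kraus operator `K = ∑ⱼ c(j) |f(j)⟩⟨j|` with `f` one-to-one on the indices with `c(j) ≠ 0`. -/
def IsStrictlyIncoherentKraus {ι κ : Type*} [DecidableEq κ] (K : Matrix κ ι ℂ) : Prop :=
  ∃ (c : ι → ℂ) (f : ι → κ), Set.InjOn f {j | c j ≠ 0} ∧
    ∀ i j, K i j = if i = f j then c j else 0

/-- Some strictly incoherent operation maps the pure state `ψ` to the pure state `φ`. -/
def SIOTransforms {ι κ : Type*} [Fintype ι] [DecidableEq ι] [Fintype κ] [DecidableEq κ]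
    (ψ : ι → ℂ) (φ : κ → ℂ) : Prop :=
  ∃ (k : ℕ) (K : Fin k → Matrix κ ι ℂ),
    (∀ l, IsStrictlyIncoherentKraus (K l)) ∧
      ∑ l, (K l).conjTranspose * K l = 1 ∧
        ∑ l, K l * ketbra ψ * (K l).conjTranspose = ketbra φ

/-! ### Cost parameter of a battery-assisted transformation -/

/-- If `T N N'` says that the transformation is possible when the battery goes from size `N`
to size `N'`, then `batteryCost T` is the infimum of `N / N'` over all possible choices. -/
def batteryCost (T : ℕ → ℕ → Prop) : ℝ≥0∞ :=
  sInf {r : ℝ≥0∞ | ∃ N N' : ℕ, 0 < N ∧ 0 < N' ∧ T N N' ∧ r = (N : ℝ≥0∞) / (N' : ℝ≥0∞)}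

/-- The optimal cost parameter of `T` is `z`, and the battery sizes for which the transformation is
possible are exactly those whose ratio is at least `z` (so the infimum that defines the cost is
attained as soon as `z` is rational). -/
def HasOptimalCost (T : ℕ → ℕ → Prop) (z : ℝ≥0∞) : Prop :=
  batteryCost T = z ∧
    ∀ N N' : ℕ, 0 < N → 0 < N' → (T N N' ↔ z ≤ (N : ℝ≥0∞) / (N' : ℝ≥0∞))

end

/-!
All four parts are compared with one condition, `TestDominates a b`: each partial sum `∑_S b` is
reached by a test on `a` of total weight at most `|S|`.

* It is equivalent to majorization. In one direction the test is read off the doubly stochastic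
  matrix; in the other, a functional separating `b` from the rearrangements of `a` is excluded by
  Abel summation (`TestDominates.mem_convexHull`), so that `b` is a mixture of rearrangements of
  `a` (`TestDominates.exists_mixture`).
* For `a = p ⊗ w_{N'}` and `b = q ⊗ w_N` it says that the Lorenz curves satisfy
  `β_x(p) ≤ (N / N') β_x(q)`, because a battery only rescales the costs of tests
  (`testDominates_tensorUniform_iff`). The ratio of the curves has a maximum, attained at one of the
  finitely many partial sums of `q`: tests on `q` form a cube, the convex hull of the indicators of
  sets (`exists_max_betaCurve_ratio`).
* A mixture of rearrangements gives Kraus operators that take a state with squared amplitudes `b`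
  to one with squared amplitudes `a`, up to the probability of the outcome
  (`TestDominates.exists_kraus`). They are strictly incoherent, and in the Schmidt bases they are
  Alice's measurement in Nielsen's protocol (`TestDominates.loccTransforms`).
* Conversely, a transformation between pure states produces a multiple of the target for each
  outcome (`exists_smul_of_sum_ketbra_eq`). A strictly incoherent Kraus operator moves basis vectors
  injectively, which gives the test at once. A protocol of local operations has product Kraus
  operators `A ⊗ B`, which do not increase the rank of a bipartite vector seen as a matrix, while
  the whole family preserves squared distances; hence the distance to the matrices of rank at most
  `k` does not grow on average. Truncating the Schmidt decomposition of the source and using the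
  Eckart–Young bound for the target (`IsSchmidtDecomposition.exists_test`) gives the test.

As the possible battery sizes are those with `z ≤ N / N'`, the infimum of `N / N'` is `z` by density
of the rationals.
-/

/-! ### Domination by tests, and majorization -/

/-- Every partial sum of `b` is dominated by a test on `a` of no larger total weight: for each
finite set `S` of indices there is `0 ≤ t ≤ 1` with `∑ t ≤ |S|` and `∑_S b ≤ t · a`. For vectors
with nonnegative entries and the same total this says that `a` majorizes `b`, but no sorting is
involved and the index types of `a` and `b` are unrelated. -/
def TestDominates {ι κ : Type*} [Fintype ι] (a : ι → ℝ) (b : κ → ℝ) : Prop :=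
  ∀ S : Finset κ, ∃ t : ι → ℝ, (∀ i, 0 ≤ t i ∧ t i ≤ 1) ∧ ∑ i, t i ≤ (S.card : ℝ) ∧
    ∑ j ∈ S, b j ≤ ∑ i, t i * a i

/-- If `a` is at least `τ ≥ 0` on `S` and at most `τ` off `S`, then the indicator of `S` is the
best test of weight at most `|S|`. -/
theorem sum_test_mul_le {ι : Type*} [Fintype ι] (a t : ι → ℝ) (S : Finset ι) (τ : ℝ)
    (hτ : 0 ≤ τ) (hS : ∀ i ∈ S, τ ≤ a i) (hS' : ∀ i ∉ S, a i ≤ τ)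
    (ht : ∀ i, 0 ≤ t i ∧ t i ≤ 1) (hcard : ∑ i, t i ≤ (S.card : ℝ)) :
    ∑ i, t i * a i ≤ ∑ i ∈ S, a i := by
  classical
  have hpt : ∀ i, t i * a i ≤ (if i ∈ S then a i else 0) + τ * t i - (if i ∈ S then τ else 0) := by
    intro i
    split_ifs with h
    · nlinarith [hS i h, (ht i).2]
    · nlinarith [hS' i h, (ht i).1]
  have hsum := Finset.sum_le_sum fun i (_ : i ∈ Finset.univ) => hpt i
  have hτS : ∑ i, (if i ∈ S then τ else 0) = τ * S.card := by
    rw [← Finset.sum_filter, Finset.filter_univ_mem, Finset.sum_const, nsmul_eq_mul, mul_comm]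
  rw [Finset.sum_sub_distrib, Finset.sum_add_distrib, ← Finset.mul_sum, hτS, ← Finset.sum_filter,
    Finset.filter_univ_mem] at hsum
  nlinarith

theorem sum_mul_nonneg_of_antitone_of_nonneg {d : ℕ} (c y : Fin d → ℝ) (hc : Antitone c)
    (hc0 : ∀ i, 0 ≤ c i) (hy : ∀ k : ℕ, k ≤ d → 0 ≤ ∑ i with (i : Fin d).val < k, y i) :
    0 ≤ ∑ i, c i * y i := by
  induction d with
  | zero => simp
  | succ d ih =>
    have hprefix : ∀ k : ℕ, k ≤ d → 0 ≤ ∑ i with (i : Fin d).val < k, y i.castSucc := by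
      intro k hk
      have h := hy k (by omega)
      rw [Finset.sum_filter, Fin.sum_univ_castSucc] at h
      rw [Finset.sum_filter]
      simpa [not_lt.mpr hk] using h
    have htot : 0 ≤ ∑ i, y i := by
      have h := hy (d + 1) le_rfl
      rwa [Finset.filter_true_of_mem fun i _ => i.isLt] at h
    have h1 := ih (fun i => c i.castSucc - c (Fin.last d)) (fun i => y i.castSucc)
      (fun i j hij => sub_le_sub_right (hc (Fin.castSucc_le_castSucc_iff.mpr hij)) _)
      (fun i => sub_nonneg.mpr (hc (Fin.le_last _))) hprefix
    have h2 := mul_nonneg (hc0 (Fin.last d)) htot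
    rw [Fin.sum_univ_castSucc] at h2 ⊢
    simp only [sub_mul, Finset.sum_sub_distrib, ← Finset.mul_sum] at h1
    linarith

/-- Abel summation: an antitone weight has nonnegative pairing with a vector of total zero whose
partial sums are nonnegative. -/
theorem sum_mul_nonneg_of_antitone {d : ℕ} (c y : Fin d → ℝ) (hc : Antitone c)
    (hy : ∀ k : ℕ, k ≤ d → 0 ≤ ∑ i with (i : Fin d).val < k, y i) (hy0 : ∑ i, y i = 0) :
    0 ≤ ∑ i, c i * y i := by
  rcases d with _ | d
  · simp
  · have h := sum_mul_nonneg_of_antitone_of_nonneg (fun i => c i - c (Fin.last d)) y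
      (fun i j hij => sub_le_sub_right (hc hij) _) (fun i => sub_nonneg.mpr (hc (Fin.le_last _))) hy
    simpa [sub_mul, Finset.sum_sub_distrib, ← Finset.mul_sum, hy0] using h

theorem exists_equiv_antitone {ι : Type*} [Fintype ι] (c : ι → ℝ) :
    ∃ e : Fin (Fintype.card ι) ≃ ι, Antitone (c ∘ e) := by
  have e₀ := (Fintype.equivFin ι).symm
  refine ⟨(Tuple.sort fun i => -c (e₀ i)).trans e₀, fun i j hij => ?_⟩
  have h := Tuple.monotone_sort (fun i => -c (e₀ i)) hij
  simpa using h

/-- The analytic half of the Hardy–Littlewood–Pólya theorem. A functional separating `b` from the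
rearrangements of `a` would, by Abel summation, be larger on the rearrangement of `a` that is
sorted in the same way as the functional. -/
theorem TestDominates.mem_convexHull {ι : Type*} [Fintype ι] {a b : ι → ℝ}
    (h : TestDominates a b) (ha : ∀ i, 0 ≤ a i) (hsum : ∑ i, a i = ∑ i, b i) :
    b ∈ convexHull ℝ (Set.range fun σ : Equiv.Perm ι => a ∘ σ) := by
  classical
  by_contra hb
  obtain ⟨F, u, hF, hu⟩ := geometric_hahn_banach_closed_point (convex_convexHull ℝ _)
    ((Set.finite_range _).isClosed_convexHull ℝ) hb
  obtain ⟨c, hc⟩ : ∃ c : ι → ℝ, ∀ v, F v = ∑ i, c i * v i := by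
    refine ⟨fun i => F (Pi.single i 1), fun v => ?_⟩
    conv_lhs => rw [← Finset.univ_sum_single v]
    rw [map_sum]
    refine Finset.sum_congr rfl fun i _ => ?_
    have : (Pi.single i (v i) : ι → ℝ) = v i • Pi.single i (1 : ℝ) := by
      rw [← Pi.single_smul, smul_eq_mul, mul_one]
    rw [this, map_smul, smul_eq_mul, mul_comm]
  obtain ⟨e, he⟩ := exists_equiv_antitone c
  obtain ⟨g, hg⟩ := exists_equiv_antitone a
  have hlt := (hF _ (subset_convexHull ℝ _ ⟨e.symm.trans g, rfl⟩)).trans hu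
  rw [hc, hc, ← e.sum_comp, ← e.sum_comp] at hlt
  simp only [Function.comp_apply, Equiv.trans_apply, Equiv.symm_apply_apply] at hlt
  have key := sum_mul_nonneg_of_antitone (c ∘ e) (fun k => a (g k) - b (e k)) he ?_ ?_
  · simp only [mul_sub, Finset.sum_sub_distrib, Function.comp_apply] at key
    linarith
  · intro k hk
    set I : Finset (Fin (Fintype.card ι)) := {i | i.val < k}
    obtain ⟨t, ht, hcard, hle⟩ := h (I.map e.toEmbedding)
    obtain ⟨τ, hτ, h1, h2⟩ : ∃ τ, 0 ≤ τ ∧ (∀ i ∈ I.map g.toEmbedding, τ ≤ a i) ∧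
        ∀ i ∉ I.map g.toEmbedding, a i ≤ τ := by
      rcases hk.lt_or_eq with hk | hk
      · refine ⟨a (g ⟨k, hk⟩), ha _, fun i hi => ?_, fun i hi => ?_⟩
        · obtain ⟨j, hj, rfl⟩ := Finset.mem_map.mp hi
          exact hg (show j ≤ ⟨k, hk⟩ from (by simpa [I] using hj : j.val < k).le)
        · obtain ⟨j, rfl⟩ := g.surjective i
          have hj : k ≤ j.val := by simpa [I] using hi
          exact hg (show (⟨k, hk⟩ : Fin _) ≤ j from hj)
      · refine ⟨0, le_rfl, fun i _ => ha i, fun i hi => ?_⟩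
        obtain ⟨j, rfl⟩ := g.surjective i
        have hj : k ≤ j.val := by simpa [I] using hi
        exact absurd j.isLt (by omega)
    have h3 := sum_test_mul_le a t _ τ hτ h1 h2 ht (by simpa using hcard)
    rw [Finset.sum_map] at h3 hle
    rw [Finset.sum_sub_distrib]
    simp only [Equiv.coe_toEmbedding] at h3 hle
    linarith
  · rw [Finset.sum_sub_distrib, g.sum_comp, e.sum_comp, hsum, sub_self]

/-- Padding `a` and `b` by zeros to the common index type `ι ⊕ κ`, the vector `b` is a mixture of
rearrangements of `a`. -/
theorem TestDominates.exists_perm_mixture {ι κ : Type*} [Fintype ι] [Fintype κ]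
    {a : ι → ℝ} {b : κ → ℝ} (h : TestDominates a b) (ha : ∀ i, 0 ≤ a i)
    (hsum : ∑ i, a i = ∑ j, b j) :
    ∃ (L : Type) (_ : Fintype L) (w : L → ℝ) (σ : L → Equiv.Perm (ι ⊕ κ)),
      (∀ l, 0 < w l) ∧ ∑ l, w l = 1 ∧
        ∀ x, (Sum.elim 0 b : ι ⊕ κ → ℝ) x = ∑ l, w l * (Sum.elim a 0 : ι ⊕ κ → ℝ) (σ l x) := by
  classical
  have h' : TestDominates (Sum.elim a 0 : ι ⊕ κ → ℝ) (Sum.elim 0 b : ι ⊕ κ → ℝ) := by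
    intro S
    obtain ⟨t, ht, hcard, hle⟩ := h S.toRight
    refine ⟨Sum.elim t 0, ?_, ?_, ?_⟩
    · rintro (i | j)
      · exact ht i
      · simp
    · have : (S.toRight.card : ℝ) ≤ S.card := by exact_mod_cast S.card_toRight_le
      simpa using hcard.trans this
    · rw [← Finset.toLeft_disjSum_toRight (u := S), Finset.sum_disjSum]
      simpa using hle
  have hmem := h'.mem_convexHull (by rintro (i | j) <;> simp [ha]) (by simpa using hsum)
  obtain ⟨L, _, w, z, hw, hw1, hz, hb⟩ := mem_convexHull_iff_exists_fintype.mp hmem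
  choose σ hσ using hz
  have hsub : ∀ G : L → ℝ, (∀ l, w l = 0 → G l = 0) → ∑ l : {l // 0 < w l}, G l = ∑ l, G l := by
    intro G hG
    rw [← Finset.sum_subtype (Finset.univ.filter fun l => 0 < w l) (by simp) G]
    refine Finset.sum_filter_of_ne fun l _ hl => ?_
    exact (hw l).lt_of_ne fun h0 => hl (hG l h0.symm)
  refine ⟨{l // 0 < w l}, inferInstance, fun l => w l, fun l => σ l, fun l => l.2,
    (hsub w fun l hl => hl).trans hw1, fun x => ?_⟩
  rw [hsub (fun l => w l * (Sum.elim a 0 : ι ⊕ κ → ℝ) (σ l x)) fun l hl => by simp [hl], ← hb,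
    Finset.sum_apply]
  exact Finset.sum_congr rfl fun l _ => by simp [← hσ]

/-- `b` is a mixture of vectors obtained from `a` by placing its nonzero entries at distinct
positions: in the `l`-th one the entry at `j ∈ T l` is the entry of `a` at `f l j`. -/
theorem TestDominates.exists_mixture {ι κ : Type*} [Fintype ι] [Fintype κ] [Nonempty ι]
    {a : ι → ℝ} {b : κ → ℝ} (h : TestDominates a b) (ha : ∀ i, 0 ≤ a i)
    (hsum : ∑ i, a i = ∑ j, b j) :
    ∃ (L : Type) (_ : Fintype L) (w : L → ℝ) (T : L → Set κ) (f : L → κ → ι),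
      (∀ l, 0 < w l) ∧ ∑ l, w l = 1 ∧ (∀ l, Set.BijOn (f l) (T l) {i | a i ≠ 0}) ∧
        ∀ j, b j = ∑ l, w l * (T l).indicator (a ∘ f l) j := by
  classical
  obtain ⟨L, _, w, σ, hw, hw1, hb⟩ := h.exists_perm_mixture ha hsum
  refine ⟨L, inferInstance, w, fun l => {j | (Sum.elim a 0 : ι ⊕ κ → ℝ) (σ l (.inr j)) ≠ 0},
    fun l j => Sum.elim id (fun _ => Classical.arbitrary ι) (σ l (.inr j)), hw, hw1,
    fun l => ⟨?_, ?_, ?_⟩, fun j => ?_⟩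
  · intro j hj
    rcases hx : σ l (.inr j) with i | k <;> simp_all
  · intro j hj k hk hjk
    rcases hx : σ l (.inr j) with i | i <;> rcases hy : σ l (.inr k) with i' | i' <;>
      simp_all only [Sum.elim_inl, Sum.elim_inr, Set.mem_ofPred_eq, Pi.zero_apply, ne_eq,
        not_true_eq_false, id_eq]
    exact Sum.inr_injective ((σ l).injective (hx.trans hy.symm))
  · intro i hi
    -- The preimage of `i` is not a padding position of `b`, since `b` vanishes there.
    rcases hx : (σ l).symm (.inl i) with k | j
    · have h0 := hb (.inl k)
      have hnn : ∀ l ∈ Finset.univ, 0 ≤ w l * (Sum.elim a 0 : ι ⊕ κ → ℝ) (σ l (.inl k)) := by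
        refine fun l _ => mul_nonneg (hw l).le ?_
        rcases σ l (.inl k) with i | i <;> simp [ha]
      have h1 := (Finset.sum_eq_zero_iff_of_nonneg hnn).mp (by simpa using h0.symm) l
        (Finset.mem_univ l)
      rw [Equiv.symm_apply_eq] at hx
      rw [← hx] at h1
      exact absurd h1 (mul_ne_zero (hw l).ne' hi)
    · rw [Equiv.symm_apply_eq] at hx
      exact ⟨j, by simpa [← hx] using hi, by simp [← hx]⟩
  · have h1 := hb (.inr j)
    rw [Sum.elim_inr] at h1
    rw [h1]
    refine Finset.sum_congr rfl fun l _ => ?_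
    congr 1
    rcases hx : σ l (.inr j) with i | k
    · by_cases hi : a i = 0 <;> simp [Set.indicator, hx, hi]
    · simp [Set.indicator, hx]

theorem Majorizes.testDominates {ι κ : Type*} [Fintype ι] {a : ι → ℝ} {b : κ → ℝ}
    (h : Majorizes a b) : TestDominates a b := by
  classical
  obtain ⟨d, e, f, M, hM, hMab⟩ := h
  have hM0 : ∀ {i j}, 0 ≤ M i j := nonneg_of_mem_doublyStochastic hM
  intro S
  refine ⟨fun i => ∑ j ∈ S, M (f j) (e i), fun i => ⟨Finset.sum_nonneg fun j _ => hM0, ?_⟩, ?_, ?_⟩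
  · dsimp only
    rw [← sum_col_of_mem_doublyStochastic hM (e i), ← Finset.sum_map S f fun k => M k (e i)]
    exact Finset.sum_le_sum_of_subset_of_nonneg (Finset.subset_univ _) fun _ _ _ => hM0
  · rw [Finset.sum_comm, Finset.card_eq_sum_ones, Nat.cast_sum]
    refine Finset.sum_le_sum fun j _ => ?_
    rw [Nat.cast_one, ← sum_row_of_mem_doublyStochastic hM (f j),
      ← Finset.sum_map Finset.univ e fun k => M (f j) k]
    exact Finset.sum_le_sum_of_subset_of_nonneg (Finset.subset_univ _) fun _ _ _ => hM0
  · simp only [Finset.sum_mul]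
    rw [Finset.sum_comm]
    refine Finset.sum_le_sum fun j _ => le_of_eq ?_
    have h1 := congrFun hMab (f j)
    rw [f.injective.extend_apply] at h1
    rw [← h1, Matrix.mulVec, dotProduct]
    have h2 : ∀ k ∉ Finset.univ.map e, M (f j) k * Function.extend e a 0 k = 0 := by
      intro k hk
      rw [Function.extend_apply' _ _ _ (by simpa using hk), Pi.zero_apply, mul_zero]
    rw [← Finset.sum_subset (Finset.subset_univ (Finset.univ.map e)) fun k _ => h2 k,
      Finset.sum_map]
    simp [e.injective.extend_apply]

theorem TestDominates.majorizes {ι κ : Type*} [Fintype ι] [Fintype κ]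
    {a : ι → ℝ} {b : κ → ℝ} (h : TestDominates a b) (ha : ∀ i, 0 ≤ a i)
    (hsum : ∑ i, a i = ∑ j, b j) : Majorizes a b := by
  classical
  obtain ⟨L, _, w, σ, hw, hw1, hb⟩ := h.exists_perm_mixture ha hsum
  let e := Fintype.equivFin (ι ⊕ κ)
  have hinl : Function.extend (Function.Embedding.inl.trans e.toEmbedding) a 0 =
      (Sum.elim a 0 : ι ⊕ κ → ℝ) ∘ e.symm := by
    funext k
    obtain ⟨x, rfl⟩ := e.surjective k
    rcases x with i | j
    · simpa using (Function.Embedding.inl.trans e.toEmbedding).injective.extend_apply a 0 i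
    · rw [Function.extend_apply']
      · simp
      · rintro ⟨i, hi⟩
        simp at hi
  have hinr : Function.extend (Function.Embedding.inr.trans e.toEmbedding) b 0 =
      (Sum.elim 0 b : ι ⊕ κ → ℝ) ∘ e.symm := by
    funext k
    obtain ⟨x, rfl⟩ := e.surjective k
    rcases x with i | j
    · rw [Function.extend_apply']
      · simp
      · rintro ⟨i, hi⟩
        simp at hi
    · simpa using (Function.Embedding.inr.trans e.toEmbedding).injective.extend_apply b 0 j
  refine ⟨_, Function.Embedding.inl.trans e.toEmbedding, Function.Embedding.inr.trans e.toEmbedding,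
    ∑ l, w l • Equiv.Perm.permMatrix ℝ ((e.symm.trans (σ l)).trans e), ?_, ?_⟩
  · exact convex_doublyStochastic.sum_mem (fun l _ => (hw l).le) hw1
      fun l _ => permMatrix_mem_doublyStochastic
  · rw [hinl, hinr, Matrix.sum_mulVec]
    funext k
    simp [Matrix.smul_mulVec, Matrix.permMatrix_mulVec, hb, Finset.sum_apply]

theorem majorizes_iff_testDominates {ι κ : Type*} [Fintype ι] [Fintype κ]
    {a : ι → ℝ} {b : κ → ℝ} (ha : ∀ i, 0 ≤ a i) (hsum : ∑ i, a i = ∑ j, b j) :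
    Majorizes a b ↔ TestDominates a b :=
  ⟨Majorizes.testDominates, fun h => h.majorizes ha hsum⟩

/-! ### The Lorenz curve of a finite vector -/

theorem tsum_mul_padSeq {n : ℕ} (p : Fin n → ℝ) (t : ℕ → ℝ≥0∞) :
    ∑' i, t i * padSeq p i = ∑ i : Fin n, t i * ENNReal.ofReal (p i) := by
  rw [tsum_eq_sum (s := Finset.range n), Finset.sum_range]
  · simp [padSeq]
  · intro i hi
    have : ¬ i < n := by simpa using hi
    simp [padSeq, this]

/-- A test on the entries of `p` bounds the Lorenz curve from above. The right-hand side is not a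
junk value, since the entries of a test are nonnegative. -/
theorem betaCurve_padSeq_le {n : ℕ} {p : Fin n → ℝ} (hp : ∀ i, 0 ≤ p i) {x : ℝ} (t : Fin n → ℝ)
    (ht : ∀ i, 0 ≤ t i ∧ t i ≤ 1) (hx : x ≤ ∑ i, t i * p i) :
    betaCurve x (padSeq p) onesSeq ≤ ENNReal.ofReal (∑ i, t i) := by
  refine iInf_le_of_le (padSeq t) (iInf₂_le_of_le (fun i => ?_) ?_ ?_)
  · unfold padSeq
    split_ifs
    · exact ENNReal.ofReal_le_one.mpr (ht _).2
    · exact zero_le_one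
  · rw [tsum_mul_padSeq]
    refine (ENNReal.ofReal_le_ofReal hx).trans (le_of_eq ?_)
    rw [ENNReal.ofReal_sum_of_nonneg fun i _ => mul_nonneg (ht i).1 (hp i)]
    exact Finset.sum_congr rfl fun i _ => by simp [padSeq, ENNReal.ofReal_mul (ht i).1]
  · have h := tsum_mul_padSeq t fun _ => 1
    simp only [one_mul] at h
    simp only [onesSeq, mul_one]
    rw [h, ENNReal.ofReal_sum_of_nonneg fun i _ => (ht i).1]

/-- A lower bound for the real tests on the entries of `p` bounds the Lorenz curve from below:
extended nonnegative tests are finite, and their entries at the padding only add to the cost. -/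
theorem le_betaCurve_padSeq {n : ℕ} {p : Fin n → ℝ} (hp : ∀ i, 0 ≤ p i) {x s : ℝ} (hx : 0 < x)
    (h : ∀ t : Fin n → ℝ, (∀ i, 0 ≤ t i ∧ t i ≤ 1) → x ≤ ∑ i, t i * p i → s ≤ ∑ i, t i) :
    ENNReal.ofReal s ≤ betaCurve x (padSeq p) onesSeq := by
  refine le_iInf fun t => le_iInf₂ fun ht hxt => ?_
  have hfin : ∀ i, t i ≠ ∞ := fun i => ne_top_of_le_ne_top ENNReal.one_ne_top (ht i)
  have key := h (fun i => (t i).toReal)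
    (fun i => ⟨ENNReal.toReal_nonneg,
      ENNReal.toReal_le_of_le_ofReal zero_le_one (by simpa using ht i)⟩)
    ?_
  · refine (ENNReal.ofReal_le_ofReal key).trans ?_
    rw [ENNReal.ofReal_sum_of_nonneg fun i _ => ENNReal.toReal_nonneg]
    simp only [onesSeq, mul_one, ENNReal.ofReal_toReal (hfin _)]
    rw [← Finset.sum_range]
    exact ENNReal.sum_le_tsum _
  · rw [tsum_mul_padSeq] at hxt
    have h1 : ∑ i : Fin n, t i * ENNReal.ofReal (p i) =
        ENNReal.ofReal (∑ i : Fin n, (t i).toReal * p i) := by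
      rw [ENNReal.ofReal_sum_of_nonneg fun i _ => mul_nonneg ENNReal.toReal_nonneg (hp i)]
      exact Finset.sum_congr rfl fun i _ => by
        rw [ENNReal.ofReal_mul ENNReal.toReal_nonneg, ENNReal.ofReal_toReal (hfin i)]
    rw [h1] at hxt
    by_contra hlt
    exact absurd hxt (not_le.mpr ((ENNReal.ofReal_lt_ofReal_iff hx).mpr (not_le.mp hlt)))

/-- The infimum defining the Lorenz curve of a probability vector is attained, by compactness of
the set of tests. -/
theorem exists_optimal_test {n : ℕ} {p : Fin n → ℝ} (hp : p ∈ stdSimplex ℝ (Fin n)) {x : ℝ}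
    (hx : 0 < x) (hx1 : x ≤ 1) :
    ∃ t : Fin n → ℝ, (∀ i, 0 ≤ t i ∧ t i ≤ 1) ∧ x ≤ ∑ i, t i * p i ∧
      betaCurve x (padSeq p) onesSeq = ENNReal.ofReal (∑ i, t i) := by
  have hK : IsCompact ((Set.univ.pi fun _ : Fin n => Set.Icc (0 : ℝ) 1) ∩
      {t | x ≤ ∑ i, t i * p i}) :=
    (isCompact_univ_pi fun _ => isCompact_Icc).inter_right
      (isClosed_le continuous_const (by fun_prop))
  have hne : ((Set.univ.pi fun _ : Fin n => Set.Icc (0 : ℝ) 1) ∩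
      {t | x ≤ ∑ i, t i * p i}).Nonempty :=
    ⟨fun _ => 1, fun _ _ => by simp, by simpa [hp.2] using hx1⟩
  obtain ⟨t, ⟨ht, hxt⟩, hmin⟩ := hK.exists_isMinOn hne
    (f := fun t : Fin n → ℝ => ∑ i, t i) (by fun_prop)
  have ht' : ∀ i, 0 ≤ t i ∧ t i ≤ 1 := fun i => ht i trivial
  refine ⟨t, ht', hxt, le_antisymm (betaCurve_padSeq_le hp.1 t ht' hxt)
    (le_betaCurve_padSeq hp.1 hx fun u hu hxu => hmin ⟨fun i _ => hu i, hxu⟩)⟩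

/-! ### The maximal ratio of two Lorenz curves -/

/-- If the tests on `p` reach the value `∑_S q` at a cost of at most `z |S|` for all sets `S` of
indices of `q`, then `z` bounds the ratio of the Lorenz curves: every test on `q` is a mixture of
indicators. -/
theorem exists_test_of_forall_finset {ι κ : Type*} [Fintype ι] [Fintype κ]
    (p : ι → ℝ) (q : κ → ℝ) (z : ℝ)
    (h : ∀ S : Finset κ, ∃ t : ι → ℝ, (∀ i, 0 ≤ t i ∧ t i ≤ 1) ∧ ∑ i, t i ≤ z * S.card ∧
      ∑ j ∈ S, q j ≤ ∑ i, t i * p i) (u : κ → ℝ) (hu : ∀ j, 0 ≤ u j ∧ u j ≤ 1) :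
    ∃ t : ι → ℝ, (∀ i, 0 ≤ t i ∧ t i ≤ 1) ∧ ∑ i, t i ≤ z * ∑ j, u j ∧
      ∑ j, u j * q j ≤ ∑ i, t i * p i := by
  classical
  let G : Set (κ → ℝ) := {u | ∃ t : ι → ℝ, (∀ i, 0 ≤ t i ∧ t i ≤ 1) ∧ ∑ i, t i ≤ z * ∑ j, u j ∧
      ∑ j, u j * q j ≤ ∑ i, t i * p i}
  have hG : Convex ℝ G := by
    rintro u ⟨t, ht, h1, h2⟩ v ⟨s, hs, h3, h4⟩ a b ha hb hab
    refine ⟨a • t + b • s, fun i => ?_, ?_, ?_⟩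
    · have h5 := ht i
      have h6 := hs i
      simp only [Pi.add_apply, Pi.smul_apply, smul_eq_mul]
      constructor
      · nlinarith [mul_nonneg ha h5.1, mul_nonneg hb h6.1]
      · nlinarith [mul_le_mul_of_nonneg_left h5.2 ha, mul_le_mul_of_nonneg_left h6.2 hb]
    · simp only [Pi.add_apply, Pi.smul_apply, smul_eq_mul, Finset.sum_add_distrib,
        ← Finset.mul_sum]
      nlinarith [mul_le_mul_of_nonneg_left h1 ha, mul_le_mul_of_nonneg_left h3 hb]
    · simp only [Pi.add_apply, Pi.smul_apply, smul_eq_mul, add_mul, mul_assoc,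
        Finset.sum_add_distrib, ← Finset.mul_sum]
      nlinarith [mul_le_mul_of_nonneg_left h2 ha, mul_le_mul_of_nonneg_left h4 hb]
  have hcube : Set.univ.pi (fun _ : κ => ({0, 1} : Set ℝ)) ⊆ G := by
    intro u hu
    obtain ⟨t, ht, h1, h2⟩ := h {j | u j = 1}
    have hval : ∀ j, u j = if u j = 1 then 1 else 0 := by
      intro j
      rcases hu j trivial with h0 | h0
      · simp [h0]
      · simp [show u j = 1 from h0]
    refine ⟨t, ht, ?_, ?_⟩
    · rw [Finset.sum_congr rfl fun j _ => hval j]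
      simpa using h1
    · rw [Finset.sum_congr rfl fun j _ => by rw [hval j]]
      simpa [Finset.sum_filter] using h2
  have hconv := convexHull_min hcube hG
  rw [convexHull_pi] at hconv
  refine hconv fun j _ => ?_
  rw [convexHull_pair, segment_eq_Icc zero_le_one]
  exact hu j

theorem betaCurve_padSeq_pos {n : ℕ} {p : Fin n → ℝ} (hp : p ∈ stdSimplex ℝ (Fin n)) {x : ℝ}
    (hx : 0 < x) : 0 < betaCurve x (padSeq p) onesSeq := by
  refine (ENNReal.ofReal_pos.mpr hx).trans_le (le_betaCurve_padSeq hp.1 hx fun t ht hxt => ?_)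
  refine hxt.trans (Finset.sum_le_sum fun i _ => mul_le_of_le_one_right (ht i).1 ?_)
  rw [← hp.2]
  exact Finset.single_le_sum (fun j _ => hp.1 j) (Finset.mem_univ i)

/-- The maximum of the ratio of the two Lorenz curves exists, and it is attained at a partial sum
of `q` on whose indices the Lorenz curve of `q` is attained. -/
theorem exists_max_betaCurve_ratio {n m : ℕ} {p : Fin n → ℝ} {q : Fin m → ℝ}
    (hp : p ∈ stdSimplex ℝ (Fin n)) (hq : q ∈ stdSimplex ℝ (Fin m)) :
    ∃ z : ℝ, 0 < z ∧
      (∀ x : ℝ, 0 < x → x ≤ 1 → betaCurve x (padSeq p) onesSeq ≤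
        ENNReal.ofReal z * betaCurve x (padSeq q) onesSeq) ∧
      ∃ S : Finset (Fin m), 0 < ∑ j ∈ S, q j ∧ 0 < S.card ∧
        betaCurve (∑ j ∈ S, q j) (padSeq p) onesSeq = ENNReal.ofReal (z * S.card) ∧
        betaCurve (∑ j ∈ S, q j) (padSeq q) onesSeq = S.card := by
  classical
  let F : Finset (Finset (Fin m)) := Finset.univ.filter fun S => 0 < ∑ j ∈ S, q j
  let r : Finset (Fin m) → ℝ := fun S =>
    (betaCurve (∑ j ∈ S, q j) (padSeq p) onesSeq).toReal / S.card
  obtain ⟨S, hS, hmax⟩ := F.exists_max_image r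
    ⟨Finset.univ, by simp [F, hq.2]⟩
  have hle1 : ∀ S : Finset (Fin m), ∑ j ∈ S, q j ≤ 1 := fun S => by
    rw [← hq.2]
    exact Finset.sum_le_sum_of_subset_of_nonneg (Finset.subset_univ _) fun j _ _ => hq.1 j
  have hcard : ∀ S : Finset (Fin m), 0 < ∑ j ∈ S, q j → (0 : ℝ) < S.card := fun S hS => by
    rw [Nat.cast_pos, Finset.card_pos]
    exact Finset.nonempty_of_sum_ne_zero hS.ne'
  have hSq : 0 < ∑ j ∈ S, q j := by simpa [F] using hS
  have hfin : ∀ {x : ℝ}, 0 < x → x ≤ 1 → betaCurve x (padSeq p) onesSeq ≠ ∞ := fun h0 h1 => by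
    obtain ⟨t, -, -, ht⟩ := exists_optimal_test hp h0 h1
    rw [ht]
    exact ENNReal.ofReal_ne_top
  have hz : 0 < r S := div_pos (ENNReal.toReal_pos (betaCurve_padSeq_pos hp hSq).ne'
    (hfin hSq (hle1 S))) (hcard S hSq)
  have hub : ∀ x : ℝ, 0 < x → x ≤ 1 → betaCurve x (padSeq p) onesSeq ≤
      ENNReal.ofReal (r S) * betaCurve x (padSeq q) onesSeq := by
    intro x h0 h1
    obtain ⟨u, hu, hxu, hβ⟩ := exists_optimal_test hq h0 h1
    obtain ⟨t, ht, h2, h3⟩ := exists_test_of_forall_finset p q (r S) (fun R => by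
      by_cases hR : 0 < ∑ j ∈ R, q j
      · obtain ⟨t, ht, h2, h3⟩ := exists_optimal_test hp hR (hle1 R)
        refine ⟨t, ht, ?_, h2⟩
        have h4 := hmax R (by simpa [F] using hR)
        rw [← div_le_iff₀ (hcard R hR)]
        refine le_trans (le_of_eq ?_) h4
        simp only [r, h3]
        rw [ENNReal.toReal_ofReal (Finset.sum_nonneg fun i _ => (ht i).1)]
      · refine ⟨0, by simp, ?_, by simpa using not_lt.mp hR⟩
        simpa using mul_nonneg hz.le (Nat.cast_nonneg _)) u hu
    rw [hβ, ← ENNReal.ofReal_mul hz.le]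
    exact (betaCurve_padSeq_le hp.1 t ht (hxu.trans h3)).trans (ENNReal.ofReal_le_ofReal h2)
  have hβp : betaCurve (∑ j ∈ S, q j) (padSeq p) onesSeq = ENNReal.ofReal (r S * S.card) := by
    rw [div_mul_cancel₀ _ (hcard S hSq).ne', ENNReal.ofReal_toReal (hfin hSq (hle1 S))]
  refine ⟨r S, hz, hub, S, hSq, by exact_mod_cast hcard S hSq, hβp, le_antisymm ?_ ?_⟩
  · refine (betaCurve_padSeq_le hq.1 (fun j => if j ∈ S then 1 else 0)
      (fun j => by split_ifs <;> simp) (by simp)).trans (le_of_eq ?_)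
    simp
  · have h1 := hub _ hSq (hle1 S)
    rw [hβp, ENNReal.ofReal_mul hz.le, ENNReal.ofReal_natCast] at h1
    exact (ENNReal.mul_le_mul_iff_right (by simpa using hz) ENNReal.ofReal_ne_top).mp h1

/-! ### Uniform batteries -/

theorem sum_tensorUniform {ι : Type*} [Fintype ι] (p : ι → ℝ) {N : ℕ} (hN : 0 < N) :
    ∑ x, tensorUniform p N x = ∑ i, p i := by
  have : (N : ℝ) ≠ 0 := by exact_mod_cast hN.ne'
  rw [Fintype.sum_prod_type]
  refine Finset.sum_congr rfl fun i _ => ?_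
  simp [tensorUniform]
  field_simp

theorem tensorUniform_nonneg {ι : Type*} {p : ι → ℝ} (hp : ∀ i, 0 ≤ p i) (N : ℕ) (x : ι × Fin N) :
    0 ≤ tensorUniform p N x := by
  have := hp x.1
  unfold tensorUniform
  positivity

/-- Attaching `w_{N'}` to `p` and `w_N` to `q` rescales the costs of tests by `N'` and `N`. -/
theorem testDominates_tensorUniform_iff {n m : ℕ} {p : Fin n → ℝ} {q : Fin m → ℝ}
    (hp : p ∈ stdSimplex ℝ (Fin n)) (hq : q ∈ stdSimplex ℝ (Fin m)) {z : ℝ} (hz : 0 < z)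
    (hub : ∀ x : ℝ, 0 < x → x ≤ 1 → betaCurve x (padSeq p) onesSeq ≤
        ENNReal.ofReal z * betaCurve x (padSeq q) onesSeq)
    {S : Finset (Fin m)} (hS : 0 < S.card)
    (hβp : betaCurve (∑ j ∈ S, q j) (padSeq p) onesSeq = ENNReal.ofReal (z * S.card))
    {N N' : ℕ} (hN : 0 < N) (hN' : 0 < N') :
    TestDominates (tensorUniform p N') (tensorUniform q N) ↔ z ≤ (N : ℝ) / N' := by
  have hNr : (0 : ℝ) < N := by exact_mod_cast hN
  have hNr' : (0 : ℝ) < N' := by exact_mod_cast hN'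
  have hSr : (0 : ℝ) < S.card := by exact_mod_cast hS
  constructor
  · intro h
    obtain ⟨t, ht, hcard, hle⟩ := h (S ×ˢ Finset.univ)
    have hx : ∑ j ∈ S ×ˢ Finset.univ, tensorUniform q N j = ∑ j ∈ S, q j := by
      rw [Finset.sum_product]
      refine Finset.sum_congr rfl fun j _ => ?_
      simp [tensorUniform]
      field_simp
    rw [hx] at hle
    have h1 := betaCurve_padSeq_le hp.1 (x := ∑ j ∈ S, q j) (fun i => (∑ k, t (i, k)) / N')
      (fun i => ⟨div_nonneg (Finset.sum_nonneg fun k _ => (ht _).1) hNr'.le, ?_⟩) ?_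
    · rw [hβp, ENNReal.ofReal_le_ofReal_iff (Finset.sum_nonneg fun i _ =>
        div_nonneg (Finset.sum_nonneg fun k _ => (ht _).1) hNr'.le), ← Finset.sum_div,
        ← Fintype.sum_prod_type, le_div_iff₀ hNr'] at h1
      rw [Finset.card_product, Finset.card_univ, Fintype.card_fin, Nat.cast_mul] at hcard
      rw [le_div_iff₀ hNr']
      nlinarith
    · rw [div_le_one hNr']
      refine (Finset.sum_le_sum fun k _ => (ht (i, k)).2).trans ?_
      simp
    · refine hle.trans (le_of_eq ?_)
      rw [Fintype.sum_prod_type]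
      refine Finset.sum_congr rfl fun i _ => ?_
      simp only [tensorUniform, ← Finset.sum_mul]
      ring
  · intro h S
    set x := ∑ j ∈ S, tensorUniform q N j with hx
    rcases le_or_gt x 0 with h0 | h0
    · exact ⟨0, by simp, by simp, by simpa using h0⟩
    have hx1 : x ≤ 1 := by
      rw [← hq.2, ← sum_tensorUniform q hN]
      exact Finset.sum_le_sum_of_subset_of_nonneg (Finset.subset_univ _)
        fun j _ _ => tensorUniform_nonneg hq.1 N j
    classical
    have hβq : betaCurve x (padSeq q) onesSeq ≤ ENNReal.ofReal (S.card / N) := by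
      have h1 := betaCurve_padSeq_le hq.1 (x := x)
        (fun j => (∑ k, if (j, k) ∈ S then (1 : ℝ) else 0) / N)
        (fun j => ⟨div_nonneg (Finset.sum_nonneg fun k _ => by split_ifs <;> simp) hNr.le, ?_⟩) ?_
      · refine h1.trans (le_of_eq ?_)
        rw [← Finset.sum_div, ← Fintype.sum_prod_type fun y => if y ∈ S then (1 : ℝ) else 0]
        simp
      · rw [div_le_one hNr]
        refine (Finset.sum_le_sum fun k _ => (?_ : _ ≤ (1 : ℝ))).trans ?_
        · split_ifs <;> simp
        · simp
      · have h2 : x = ∑ j, if j ∈ S then tensorUniform q N j else 0 := by simp [hx]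
        rw [h2, Fintype.sum_prod_type]
        refine Finset.sum_le_sum fun j _ => le_of_eq ?_
        rw [Finset.sum_div, Finset.sum_mul]
        refine Finset.sum_congr rfl fun k _ => ?_
        unfold tensorUniform
        split_ifs <;> ring
    obtain ⟨t, ht, hxt, hβ⟩ := exists_optimal_test hp h0 hx1
    refine ⟨fun i => t i.1, fun i => ht i.1, ?_, ?_⟩
    · have h1 := (hub x h0 hx1).trans (mul_le_mul_right hβq (ENNReal.ofReal z))
      rw [hβ, ← ENNReal.ofReal_mul hz.le, ENNReal.ofReal_le_ofReal_iff (by positivity)] at h1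
      have h2 : z * (S.card / N) ≤ S.card / N' := by
        calc z * (S.card / N) ≤ N / N' * (S.card / N) := by gcongr
          _ = S.card / N' := by field_simp
      rw [le_div_iff₀ hNr'] at h2
      simp only [Fintype.sum_prod_type, Finset.sum_const, Finset.card_univ, Fintype.card_fin,
        nsmul_eq_mul, ← Finset.mul_sum]
      nlinarith
    · refine hxt.trans (le_of_eq ?_)
      rw [Fintype.sum_prod_type]
      refine Finset.sum_congr rfl fun i _ => ?_
      simp [tensorUniform]
      field_simp

/-- If the possible battery sizes are those with `z ≤ N / N'`, the optimal cost is `z`, since the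
rationals are dense. -/
theorem hasOptimalCost_of_iff {T : ℕ → ℕ → Prop} {z : ℝ≥0∞}
    (h : ∀ N N' : ℕ, 0 < N → 0 < N' → (T N N' ↔ z ≤ (N : ℝ≥0∞) / (N' : ℝ≥0∞))) :
    HasOptimalCost T z := by
  refine ⟨le_antisymm (le_of_forall_gt fun r hr => ?_) ?_, h⟩
  · obtain ⟨s, hs0, hzs, hsr⟩ := ENNReal.lt_iff_exists_rat_btwn.mp hr
    have hpos : 0 < s := by
      by_contra h0
      have : Real.toNNReal (s : ℝ) = 0 := Real.toNNReal_of_nonpos (by exact_mod_cast not_lt.mp h0)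
      rw [this] at hzs
      simp at hzs
    have hnum : 0 < s.num.toNat := by have := Rat.num_pos.mpr hpos; omega
    have hs : ((Real.toNNReal (s : ℝ) : NNReal) : ℝ≥0∞) = (s.num.toNat : ℝ≥0∞) / (s.den : ℝ≥0∞) := by
      have h1 : (s : ℝ) = (s.num.toNat : ℝ) / s.den := by
        have h2 : ((s.num.toNat : ℤ) : ℝ) = s.num := by
          rw [Int.toNat_of_nonneg (Rat.num_pos.mpr hpos).le]
        rw [Rat.cast_def, ← h2, Int.cast_natCast]
      change ENNReal.ofReal (s : ℝ) = _
      rw [h1, ENNReal.ofReal_div_of_pos (by exact_mod_cast s.den_pos), ENNReal.ofReal_natCast,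
        ENNReal.ofReal_natCast]
    refine lt_of_le_of_lt (sInf_le ?_) hsr
    exact ⟨s.num.toNat, s.den, hnum, s.den_pos, (h _ _ hnum s.den_pos).mpr (hs ▸ hzs.le), hs⟩
  · refine le_sInf ?_
    rintro r ⟨N, N', hN, hN', hT, rfl⟩
    exact (h N N' hN hN').mp hT

/-! ### Pure states and Kraus operators -/

theorem mul_ketbra_mul_conjTranspose {ι κ : Type*} [Fintype ι] (K : Matrix κ ι ℂ) (ψ : ι → ℂ) :
    K * ketbra ψ * K.conjTranspose = ketbra (K.mulVec ψ) := by
  rw [ketbra, Matrix.mul_vecMulVec, Matrix.vecMulVec_mul, ← Matrix.star_mulVec, ketbra]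

theorem ketbra_smul {ι : Type*} (c : ℂ) (ψ : ι → ℂ) :
    ketbra (c • ψ) = ((‖c‖ ^ 2 : ℝ) : ℂ) • ketbra ψ := by
  ext i j
  have h : c * (starRingEnd ℂ) c = ((‖c‖ ^ 2 : ℝ) : ℂ) := by
    rw [Complex.mul_conj, Complex.normSq_eq_norm_sq]
  simp only [ketbra, Matrix.vecMulVec_apply, Matrix.smul_apply, Pi.smul_apply, Pi.star_apply,
    smul_eq_mul, star_mul', ← h, RCLike.star_def]
  ring

theorem star_dotProduct_ketbra_mulVec {ι : Type*} [Fintype ι] (φ v : ι → ℂ) :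
    star v ⬝ᵥ (ketbra φ).mulVec v = ((‖star φ ⬝ᵥ v‖ ^ 2 : ℝ) : ℂ) := by
  rw [ketbra, Matrix.vecMulVec_mulVec, dotProduct_smul, op_smul_eq_mul,
    ← Complex.normSq_eq_norm_sq, Complex.normSq_eq_conj_mul_self, starRingEnd_apply,
    Matrix.star_dotProduct]

open scoped ComplexOrder in
/-- Pure states are extreme: if a sum of rank-one operators is rank one, all the summands are
multiples of it. -/
theorem exists_smul_of_sum_ketbra_eq {ι L : Type*} [Fintype ι] [Fintype L]
    (χ : L → ι → ℂ) {φ : ι → ℂ} (hφ : φ ≠ 0) (h : ∑ l, ketbra (χ l) = ketbra φ) :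
    ∃ c : L → ℂ, (∀ l, χ l = c l • φ) ∧ ∑ l, ‖c l‖ ^ 2 = 1 := by
  have hφφ : star φ ⬝ᵥ φ ≠ 0 := fun h0 => hφ (dotProduct_star_self_eq_zero.mp h0)
  let c : L → ℂ := fun l => (star φ ⬝ᵥ χ l) / (star φ ⬝ᵥ φ)
  have hc : ∀ l, χ l = c l • φ := by
    intro l
    set v := χ l - c l • φ with hv
    have h1 : star φ ⬝ᵥ v = 0 := by
      rw [hv, dotProduct_sub, dotProduct_smul, smul_eq_mul, div_mul_cancel₀ _ hφφ, sub_self]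
    have h2 : ∑ l, ‖star (χ l) ⬝ᵥ v‖ ^ 2 = 0 := by
      have h3 := congrArg (fun M => star v ⬝ᵥ M.mulVec v) h
      simp only [Matrix.sum_mulVec, dotProduct_sum, star_dotProduct_ketbra_mulVec, h1] at h3
      have h4 : ((∑ l, ‖star (χ l) ⬝ᵥ v‖ ^ 2 : ℝ) : ℂ) = 0 := by
        push_cast
        simpa using h3
      exact_mod_cast h4
    have h5 : star (χ l) ⬝ᵥ v = 0 := by
      simpa using (Finset.sum_eq_zero_iff_of_nonneg fun l _ => by positivity).mp h2 l
        (Finset.mem_univ l)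
    have h6 : star v ⬝ᵥ v = 0 := by
      conv_lhs => rw [hv, star_sub, star_smul, ← hv]
      rw [sub_dotProduct, smul_dotProduct, h5, h1, smul_zero, sub_zero]
    exact sub_eq_zero.mp (dotProduct_star_self_eq_zero.mp h6)
  refine ⟨c, hc, ?_⟩
  obtain ⟨i, hi⟩ := Function.ne_iff.mp hφ
  have h1 : (∑ l, ((‖c l‖ ^ 2 : ℝ) : ℂ)) • ketbra φ = ketbra φ := by
    rw [← h, Finset.sum_smul]
    exact Finset.sum_congr rfl fun l _ => by rw [hc l, ketbra_smul, h]
  have h2 := congrFun (congrFun h1 i) i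
  have h3 : ketbra φ i i ≠ 0 := by
    simpa [ketbra, Matrix.vecMulVec_apply] using hi
  rw [Matrix.smul_apply, smul_eq_mul] at h2
  have h4 := mul_right_cancel₀ h3 (h2.trans (one_mul _).symm)
  exact_mod_cast h4

/-! ### Monomial matrices -/

/-- The matrix `∑ⱼ c(j) |f(j)⟩⟨j|`. -/
def monomialMatrix {ι κ : Type*} [DecidableEq ι] (c : κ → ℂ) (f : κ → ι) : Matrix ι κ ℂ :=
  Matrix.of fun i j => if i = f j then c j else 0

theorem conjTranspose_monomialMatrix_mul_self {ι κ : Type*} [Fintype ι] [DecidableEq ι]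
    [DecidableEq κ] {c : κ → ℂ} {f : κ → ι} (hf : Set.InjOn f {j | c j ≠ 0}) :
    (monomialMatrix c f).conjTranspose * monomialMatrix c f =
      Matrix.diagonal fun j => ((‖c j‖ ^ 2 : ℝ) : ℂ) := by
  ext j k
  rw [Matrix.mul_apply, Finset.sum_eq_single (f k)]
  · by_cases hjk : j = k
    · subst hjk
      simp [monomialMatrix, Matrix.conjTranspose_apply, Complex.conj_mul']
    · rw [Matrix.diagonal_apply_ne _ hjk]
      by_cases hj : c j = 0
      · simp [monomialMatrix, Matrix.conjTranspose_apply, hj]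
      by_cases hk : c k = 0
      · simp [monomialMatrix, hk]
      have : f k ≠ f j := fun h => hjk (hf hj hk h.symm)
      simp [monomialMatrix, Matrix.conjTranspose_apply, this]
  · intro i _ hi
    simp [monomialMatrix, hi]
  · simp

theorem monomialMatrix_mulVec_apply {ι κ : Type*} [Fintype κ] [DecidableEq ι] (c : κ → ℂ)
    (f : κ → ι) (ψ : κ → ℂ) (i : ι) :
    (monomialMatrix c f).mulVec ψ i = ∑ j, if i = f j then c j * ψ j else 0 := by
  simp [monomialMatrix, Matrix.mulVec, dotProduct, ite_mul]

theorem monomialMatrix_mulVec_apply_self {ι κ : Type*} [Fintype κ] [DecidableEq ι] {c : κ → ℂ}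
    {f : κ → ι} (hf : Set.InjOn f {j | c j ≠ 0}) (ψ : κ → ℂ) {j : κ} (hj : c j ≠ 0) :
    (monomialMatrix c f).mulVec ψ (f j) = c j * ψ j := by
  rw [monomialMatrix_mulVec_apply, Finset.sum_eq_single j]
  · simp
  · intro k _ hk
    by_cases hck : c k = 0
    · simp [hck]
    · have : f j ≠ f k := fun h => hk (hf hck hj h.symm)
      simp [this]
  · simp

theorem sum_ite_eq_indicator_of_bijOn {ι κ : Type*} [Fintype κ] [DecidableEq ι] {φ : ι → ℂ}
    {T : Set κ} {f : κ → ι} (hf : Set.BijOn f T {i | φ i ≠ 0}) (i : ι) :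
    (∑ j, if i = f j then T.indicator (φ ∘ f) j else 0) = φ i := by
  by_cases hi : φ i = 0
  · rw [hi]
    refine Finset.sum_eq_zero fun j _ => ?_
    split_ifs with h
    · by_cases hj : j ∈ T <;> simp [hj, ← h, hi]
    · rfl
  · obtain ⟨j, hj, rfl⟩ := hf.surjOn hi
    rw [Finset.sum_eq_single j]
    · simp [hj]
    · intro k _ hk
      split_ifs with h
      · have : k ∉ T := fun hkT => hk (hf.injOn hkT hj h.symm)
        simp [this]
      · rfl
    · simp

/-- The measurement behind both transformations. If the squared amplitudes of `φ` dominate those of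
`ψ`, there are Kraus operators, complete on the support of `ψ`, of which the `l`-th sends the
basis vector at `j ∈ T l` to a multiple of the one at `f l j` and takes `ψ` to `√(w l) φ`. -/
theorem TestDominates.exists_kraus {ι κ : Type*} [Fintype ι] [DecidableEq ι] [Fintype κ]
    [DecidableEq κ] [Nonempty ι] {φ : ι → ℂ} {ψ : κ → ℂ}
    (h : TestDominates (fun i => ‖φ i‖ ^ 2) (fun j => ‖ψ j‖ ^ 2))
    (hsum : ∑ i, ‖φ i‖ ^ 2 = ∑ j, ‖ψ j‖ ^ 2) :
    ∃ (L : Type) (_ : Fintype L) (w : L → ℝ) (T : L → Set κ) (f : L → κ → ι) (c : L → κ → ℂ),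
      (∀ l, 0 ≤ w l) ∧ ∑ l, w l = 1 ∧ (∀ l, Set.BijOn (f l) (T l) {i | φ i ≠ 0}) ∧
      (∀ l j, c l j * ψ j = (T l).indicator (fun j => (√(w l) : ℂ) * φ (f l j)) j) ∧
      (∀ l j, c l j ≠ 0 → j ∈ T l) ∧
      ∑ l, (monomialMatrix (c l) (f l)).conjTranspose * monomialMatrix (c l) (f l) =
        Matrix.diagonal fun j => if ψ j = 0 then 0 else 1 := by
  obtain ⟨L, _, w, T, f, hw, hw1, hf, hb⟩ := h.exists_mixture (fun i => by positivity) hsum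
  have hf' : ∀ l, Set.BijOn (f l) (T l) {i | φ i ≠ 0} := fun l => by simpa using hf l
  have hc : ∀ l j, (T l).indicator (fun j => (√(w l) : ℂ) * φ (f l j) / ψ j) j ≠ 0 → j ∈ T l :=
    fun l j => Set.mem_of_indicator_ne_zero
  have hT : ∀ l, ∀ j ∈ T l, ψ j ≠ 0 := by
    intro l j hj h0
    have h1 := hb j
    have hnn : ∀ l ∈ Finset.univ, 0 ≤ w l * (T l).indicator ((fun i => ‖φ i‖ ^ 2) ∘ f l) j :=
      fun l _ => mul_nonneg (hw l).le (Set.indicator_nonneg (fun j _ => by simp) j)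
    have h2 := (Finset.sum_eq_zero_iff_of_nonneg hnn).mp
      (by rw [← h1, h0, norm_zero]; norm_num) l (Finset.mem_univ l)
    have h3 := (hf' l).mapsTo hj
    rw [Set.indicator_of_mem hj] at h2
    exact mul_ne_zero (hw l).ne' (pow_ne_zero 2 (norm_ne_zero_iff.mpr h3)) h2
  refine ⟨L, inferInstance, w, T, f,
    fun l => (T l).indicator fun j => (√(w l) : ℂ) * φ (f l j) / ψ j, fun l => (hw l).le, hw1, hf',
    fun l j => ?_, hc, ?_⟩
  · by_cases hj : j ∈ T l
    · simp [hj, hT l j hj]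
    · simp [hj]
  · rw [Finset.sum_congr rfl fun l _ =>
      conjTranspose_monomialMatrix_mul_self ((hf' l).injOn.mono (hc l))]
    ext j k
    rw [Matrix.sum_apply]
    by_cases hjk : j = k
    · subst hjk
      simp only [Matrix.diagonal_apply_eq]
      by_cases h0 : ψ j = 0
      · simp [h0, Set.indicator]
      · have h1 : ∀ l, ‖(T l).indicator (fun j => (√(w l) : ℂ) * φ (f l j) / ψ j) j‖ ^ 2 =
            (w l * (T l).indicator ((fun i => ‖φ i‖ ^ 2) ∘ f l) j) / ‖ψ j‖ ^ 2 := by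
          intro l
          by_cases hj : j ∈ T l
          · simp [hj, mul_pow, div_pow, Real.sq_sqrt (hw l).le]
          · simp [hj]
        simp only [h1, if_neg h0, ← Complex.ofReal_sum, ← Finset.sum_div, ← hb]
        rw [div_self (by simpa using h0), Complex.ofReal_one]
    · simp [Matrix.diagonal_apply_ne _ hjk]

/-! ### Strictly incoherent operations -/

theorem sioTransforms_of_fintype {ι κ L : Type*} [Fintype ι] [DecidableEq ι] [Fintype κ]
    [DecidableEq κ] [Fintype L] {ψ : ι → ℂ} {φ : κ → ℂ} (K : L → Matrix κ ι ℂ)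
    (hK : ∀ l, IsStrictlyIncoherentKraus (K l)) (h1 : ∑ l, (K l).conjTranspose * K l = 1)
    (h2 : ∑ l, K l * ketbra ψ * (K l).conjTranspose = ketbra φ) : SIOTransforms ψ φ := by
  let e := (Fintype.equivFin L).symm
  exact ⟨_, K ∘ e, fun l => hK _, by rw [← h1, ← e.sum_comp]; rfl,
    by rw [← h2, ← e.sum_comp]; rfl⟩

theorem isStrictlyIncoherentKraus_monomialMatrix {ι κ : Type*} [DecidableEq κ] {c : ι → ℂ}
    {f : ι → κ} (hf : Set.InjOn f {j | c j ≠ 0}) :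
    IsStrictlyIncoherentKraus (monomialMatrix c f) :=
  ⟨c, f, hf, fun _ _ => rfl⟩

theorem TestDominates.sioTransforms {ι κ : Type*} [Fintype ι] [DecidableEq ι] [Fintype κ]
    [DecidableEq κ] [Nonempty ι] {φ : ι → ℂ} {ψ : κ → ℂ}
    (h : TestDominates (fun i => ‖φ i‖ ^ 2) (fun j => ‖ψ j‖ ^ 2))
    (hsum : ∑ i, ‖φ i‖ ^ 2 = ∑ j, ‖ψ j‖ ^ 2) : SIOTransforms ψ φ := by
  obtain ⟨L, _, w, T, f, c, hw, hw1, hf, hcψ, hcT, hcomplete⟩ := h.exists_kraus hsum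
  -- Basis vectors on which `ψ` vanishes are sent to a fixed one, each by a Kraus operator.
  let c₀ : κ → κ → ℂ := fun k => Pi.single k (if ψ k = 0 then 1 else 0)
  let f₀ : κ → ι := fun _ => Classical.arbitrary ι
  have hf₀ : ∀ k, Set.InjOn f₀ {j | c₀ k j ≠ 0} := by
    have : ∀ k j, c₀ k j ≠ 0 → j = k := fun k j hj => by
      by_contra hjk
      simp [c₀, hjk] at hj
    exact fun k i hi j hj _ => (this k i hi).trans (this k j hj).symm
  have hf₁ : ∀ l, Set.InjOn (f l) {j | c l j ≠ 0} := fun l => (hf l).injOn.mono (hcT l)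
  refine sioTransforms_of_fintype
    (Sum.elim (fun l => monomialMatrix (c l) (f l)) fun k => monomialMatrix (c₀ k) f₀) ?_ ?_ ?_
  · rintro (l | k)
    · exact isStrictlyIncoherentKraus_monomialMatrix (hf₁ l)
    · exact isStrictlyIncoherentKraus_monomialMatrix (hf₀ k)
  · simp only [Fintype.sum_sum_type, Sum.elim_inl, Sum.elim_inr]
    rw [hcomplete, Finset.sum_congr rfl fun k _ => conjTranspose_monomialMatrix_mul_self (hf₀ k)]
    ext i j
    rw [Matrix.add_apply, Matrix.sum_apply]
    by_cases hij : i = j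
    · subst hij
      simp only [Matrix.diagonal_apply_eq, Matrix.one_apply_eq]
      rw [Finset.sum_eq_single i]
      · by_cases h0 : ψ i = 0 <;> simp [c₀, h0]
      · intro k _ hk
        simp [c₀, hk.symm]
      · simp
    · simp [Matrix.diagonal_apply_ne _ hij, Matrix.one_apply_ne hij]
  · simp only [Fintype.sum_sum_type, Sum.elim_inl, Sum.elim_inr, mul_ketbra_mul_conjTranspose]
    have h1 : ∀ l, (monomialMatrix (c l) (f l)).mulVec ψ = (√(w l) : ℂ) • φ := by
      intro l
      funext i
      rw [monomialMatrix_mulVec_apply, Pi.smul_apply, smul_eq_mul,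
        ← sum_ite_eq_indicator_of_bijOn (hf l) i, Finset.mul_sum]
      refine Finset.sum_congr rfl fun j _ => ?_
      by_cases hj : j ∈ T l <;> simp [hcψ, hj]
    have h2 : ∀ k, (monomialMatrix (c₀ k) f₀).mulVec ψ = 0 := by
      intro k
      funext i
      rw [monomialMatrix_mulVec_apply]
      refine Finset.sum_eq_zero fun j _ => ?_
      by_cases hjk : j = k
      · subst hjk
        by_cases h0 : ψ j = 0 <;> simp [c₀, h0]
      · simp [c₀, hjk]
    have h3 : ketbra (0 : ι → ℂ) = 0 := by simp [ketbra]
    simp only [h1, h2, h3, Finset.sum_const_zero, add_zero, ketbra_smul, ← Finset.sum_smul]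
    have h4 : ∀ l, ‖((√(w l) : ℝ) : ℂ)‖ ^ 2 = w l := fun l => by
      rw [Complex.norm_real, Real.norm_eq_abs, sq_abs, Real.sq_sqrt (hw l)]
    simp only [h4, ← Complex.ofReal_sum, hw1, Complex.ofReal_one, one_smul]

/-- Each Kraus operator maps the basis vectors of `S` that it does not annihilate to distinct basis
vectors. The test is the mixture of the indicators of these images, weighted by the probabilities
of the outcomes. -/
theorem SIOTransforms.testDominates {ι κ : Type*} [Fintype ι] [DecidableEq ι] [Fintype κ]
    [DecidableEq κ] {φ : ι → ℂ} {ψ : κ → ℂ} (h : SIOTransforms ψ φ) (hφ : φ ≠ 0) :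
    TestDominates (fun i => ‖φ i‖ ^ 2) (fun j => ‖ψ j‖ ^ 2) := by
  obtain ⟨k, K, hK, hcomplete, hout⟩ := h
  choose c f hf hKc using hK
  have hKm : ∀ l, K l = monomialMatrix (c l) (f l) := fun l => by
    ext i j
    exact hKc l i j
  simp only [mul_ketbra_mul_conjTranspose] at hout
  obtain ⟨d, hd, hd1⟩ := exists_smul_of_sum_ketbra_eq _ hφ hout
  have hc1 : ∀ j, ∑ l, ‖c l j‖ ^ 2 = 1 := by
    intro j
    have h1 := congrFun (congrFun hcomplete j) j
    rw [Finset.sum_congr rfl fun l _ => by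
      rw [hKm l, conjTranspose_monomialMatrix_mul_self (hf l)]] at h1
    simp only [Matrix.sum_apply, Matrix.diagonal_apply_eq, Matrix.one_apply_eq] at h1
    exact_mod_cast h1
  intro S
  let R : Fin k → Finset ι := fun l => (S.filter fun j => c l j ≠ 0).image (f l)
  refine ⟨fun i => ∑ l, ‖d l‖ ^ 2 * if i ∈ R l then 1 else 0, fun i => ⟨?_, ?_⟩, ?_, le_of_eq ?_⟩
  · exact Finset.sum_nonneg fun l _ => mul_nonneg (by positivity) (by split_ifs <;> simp)
  · refine le_trans (Finset.sum_le_sum fun l _ => ?_) hd1.le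
    by_cases hi : i ∈ R l <;> simp [hi]
  · rw [Finset.sum_comm]
    calc ∑ l, ∑ i, ‖d l‖ ^ 2 * (if i ∈ R l then (1 : ℝ) else 0)
        = ∑ l, ‖d l‖ ^ 2 * (R l).card := by
          refine Finset.sum_congr rfl fun l _ => ?_
          rw [← Finset.mul_sum]
          simp
      _ ≤ ∑ l, ‖d l‖ ^ 2 * S.card := by
          refine Finset.sum_le_sum fun l _ => mul_le_mul_of_nonneg_left ?_ (by positivity)
          exact_mod_cast Finset.card_image_le.trans (Finset.card_filter_le _ _)
      _ = S.card := by rw [← Finset.sum_mul, hd1, one_mul]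
  · have hamp : ∀ l j, c l j ≠ 0 → d l * φ (f l j) = c l j * ψ j := by
      intro l j hj
      rw [← monomialMatrix_mulVec_apply_self (hf l) ψ hj, ← hKm, hd l]
      rfl
    calc ∑ j ∈ S, ‖ψ j‖ ^ 2 = ∑ j ∈ S, ∑ l, ‖c l j * ψ j‖ ^ 2 := by
          refine Finset.sum_congr rfl fun j _ => ?_
          simp only [norm_mul, mul_pow, ← Finset.sum_mul, hc1, one_mul]
      _ = ∑ l, ∑ j ∈ S, ‖c l j * ψ j‖ ^ 2 := Finset.sum_comm
      _ = ∑ l, ∑ i ∈ R l, ‖d l * φ i‖ ^ 2 := by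
          refine Finset.sum_congr rfl fun l _ => ?_
          have hinj : Set.InjOn (f l) (S.filter fun j => c l j ≠ 0) := (hf l).mono fun j hj => by
            simpa using (Finset.mem_filter.mp hj).2
          rw [Finset.sum_image hinj, Finset.sum_filter]
          refine Finset.sum_congr rfl fun j _ => ?_
          by_cases hj : c l j = 0
          · simp [hj]
          · rw [if_pos hj, hamp l j hj]
      _ = ∑ l, ∑ i, ‖d l‖ ^ 2 * (if i ∈ R l then 1 else 0) * ‖φ i‖ ^ 2 := by
          refine Finset.sum_congr rfl fun l _ => ?_
          simp [mul_pow, mul_ite, ite_mul]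
      _ = _ := by
          rw [Finset.sum_comm]
          exact Finset.sum_congr rfl fun i _ => by rw [Finset.sum_mul]

theorem sioTransforms_iff_testDominates {ι κ : Type*} [Fintype ι] [DecidableEq ι] [Fintype κ]
    [DecidableEq κ] [Nonempty ι] {φ : ι → ℂ} {ψ : κ → ℂ} (hφ : φ ≠ 0)
    (hsum : ∑ i, ‖φ i‖ ^ 2 = ∑ j, ‖ψ j‖ ^ 2) :
    SIOTransforms ψ φ ↔ TestDominates (fun i => ‖φ i‖ ^ 2) (fun j => ‖ψ j‖ ^ 2) :=
  ⟨fun h => h.testDominates hφ, fun h => h.sioTransforms hsum⟩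

/-! ### Operations by local operations and classical communication are separable -/

theorem sum_conjTranspose_mul_self_sigma {ι ρ τ : Type*} {σ L : ι → Type*} [Fintype ι] [Fintype τ]
    [∀ i, Fintype (σ i)] [∀ i, DecidableEq (σ i)] [DecidableEq ρ] [∀ i, Fintype (L i)]
    (M : ∀ i, L i → Matrix τ (σ i) ℂ) (K : ∀ i, Matrix (σ i) ρ ℂ)
    (hM : ∀ i, ∑ l, (M i l).conjTranspose * M i l = 1)
    (hK : ∑ i, (K i).conjTranspose * K i = 1) :
    ∑ x : Σ i, L i, (M x.1 x.2 * K x.1).conjTranspose * (M x.1 x.2 * K x.1) = 1 := by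
  rw [Fintype.sum_sigma, ← hK]
  refine Finset.sum_congr rfl fun i _ => ?_
  calc _ = (K i).conjTranspose * (∑ l, (M i l).conjTranspose * M i l) * K i := by
        rw [Matrix.mul_sum, Matrix.sum_mul]
        exact Finset.sum_congr rfl fun l _ => by
          simp only [Matrix.conjTranspose_mul, Matrix.mul_assoc]
    _ = _ := by rw [hM, Matrix.mul_one]

/-- A protocol of local operations and classical communication has product Kraus operators, one for
each record of outcomes. -/
theorem IsLOCC.exists_separable_kraus {α β α' β' : Type} [Fintype α] [DecidableEq α] [Fintype β]
    [DecidableEq β] [Fintype α'] [DecidableEq α'] [Fintype β'] [DecidableEq β']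
    {E : Matrix (α × β) (α × β) ℂ → Matrix (α' × β') (α' × β') ℂ} (h : IsLOCC α' β' α β E) :
    ∃ (L : Type) (_ : Fintype L) (A : L → Matrix α' α ℂ) (B : L → Matrix β' β ℂ),
      (∀ ρ, E ρ = ∑ l, (A l ⊗ₖ B l) * ρ * (A l ⊗ₖ B l).conjTranspose) ∧
        ∑ l, (A l ⊗ₖ B l).conjTranspose * (A l ⊗ₖ B l) = 1 := by
  induction h with
  | finish => exact ⟨Unit, inferInstance, fun _ => 1, fun _ => 1, by simp, by simp⟩
  | @alice α β _ _ _ _ k γ _ _ K hK E hE ih =>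
    choose L _ A B hAB h1 using ih
    have hmul : ∀ i l, (A i l * K i) ⊗ₖ B i l = (A i l ⊗ₖ B i l) * (K i ⊗ₖ (1 : Matrix β β ℂ)) :=
      fun i l => by rw [← Matrix.mul_kronecker_mul, Matrix.mul_one]
    refine ⟨Σ i, L i, inferInstance, fun x => A x.1 x.2 * K x.1, fun x => B x.1 x.2,
      fun ρ => ?_, ?_⟩
    · rw [Fintype.sum_sigma]
      refine Finset.sum_congr rfl fun i _ => ?_
      rw [hAB]
      refine Finset.sum_congr rfl fun l _ => ?_
      rw [hmul, Matrix.conjTranspose_mul]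
      simp only [Matrix.mul_assoc]
    · have h2 : ∑ i, (K i ⊗ₖ (1 : Matrix β β ℂ)).conjTranspose *
          (K i ⊗ₖ (1 : Matrix β β ℂ)) = 1 := by
        rw [← Matrix.one_kronecker_one, ← hK]
        ext x y
        simp [Matrix.conjTranspose_kronecker, ← Matrix.mul_kronecker_mul, Matrix.sum_apply,
          Matrix.kroneckerMap_apply, Finset.sum_mul]
      simp only [hmul]
      exact sum_conjTranspose_mul_self_sigma (σ := fun i => γ i × β) (L := L)
        (fun i l => A i l ⊗ₖ B i l) (fun i => K i ⊗ₖ (1 : Matrix β β ℂ)) h1 h2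
  | @bob α β _ _ _ _ k γ _ _ K hK E hE ih =>
    choose L _ A B hAB h1 using ih
    have hmul : ∀ i l, A i l ⊗ₖ (B i l * K i) = (A i l ⊗ₖ B i l) * ((1 : Matrix α α ℂ) ⊗ₖ K i) :=
      fun i l => by rw [← Matrix.mul_kronecker_mul, Matrix.mul_one]
    refine ⟨Σ i, L i, inferInstance, fun x => A x.1 x.2, fun x => B x.1 x.2 * K x.1,
      fun ρ => ?_, ?_⟩
    · rw [Fintype.sum_sigma]
      refine Finset.sum_congr rfl fun i _ => ?_
      rw [hAB]
      refine Finset.sum_congr rfl fun l _ => ?_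
      rw [hmul, Matrix.conjTranspose_mul]
      simp only [Matrix.mul_assoc]
    · have h2 : ∑ i, ((1 : Matrix α α ℂ) ⊗ₖ K i).conjTranspose *
          ((1 : Matrix α α ℂ) ⊗ₖ K i) = 1 := by
        rw [← Matrix.one_kronecker_one, ← hK]
        ext x y
        simp [Matrix.conjTranspose_kronecker, ← Matrix.mul_kronecker_mul, Matrix.sum_apply,
          Matrix.kroneckerMap_apply, Finset.mul_sum]
      simp only [hmul]
      exact sum_conjTranspose_mul_self_sigma (σ := fun i => α × γ i) (L := L)
        (fun i l => A i l ⊗ₖ B i l) (fun i => (1 : Matrix α α ℂ) ⊗ₖ K i) h1 h2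

theorem kronecker_mulVec_apply {α β α' β' : Type*} [Fintype α] [Fintype β]
    (A : Matrix α' α ℂ) (B : Matrix β' β ℂ) (ψ : α × β → ℂ) (x : α' × β') :
    (A ⊗ₖ B).mulVec ψ x = (A * (Matrix.of fun a b => ψ (a, b)) * B.transpose) x.1 x.2 := by
  simp only [Matrix.mulVec, dotProduct, Fintype.sum_prod_type, Matrix.mul_apply,
    Matrix.kroneckerMap_apply, Matrix.of_apply, Matrix.transpose_apply, Finset.sum_mul]
  rw [Finset.sum_comm]
  exact Finset.sum_congr rfl fun b _ => Finset.sum_congr rfl fun a _ => by ring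

theorem star_dotProduct_self_eq_sum {ι : Type*} [Fintype ι] (v : ι → ℂ) :
    star v ⬝ᵥ v = ((∑ x, ‖v x‖ ^ 2 : ℝ) : ℂ) := by
  simp [dotProduct, Complex.conj_mul']

theorem sum_norm_sq_mulVec {ι κ L : Type*} [Fintype ι] [DecidableEq ι] [Fintype κ] [Fintype L]
    {K : L → Matrix κ ι ℂ} (hK : ∑ l, (K l).conjTranspose * K l = 1) (v : ι → ℂ) :
    ∑ l, ∑ x, ‖(K l).mulVec v x‖ ^ 2 = ∑ x, ‖v x‖ ^ 2 := by
  have h1 := congrArg (fun M => star v ⬝ᵥ M.mulVec v) hK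
  simp only [Matrix.sum_mulVec, dotProduct_sum, Matrix.one_mulVec, ← Matrix.mulVec_mulVec] at h1
  rw [star_dotProduct_self_eq_sum, Finset.sum_congr rfl fun l _ => by
    rw [Matrix.dotProduct_mulVec, ← Matrix.star_mulVec, star_dotProduct_self_eq_sum],
    ← Complex.ofReal_sum] at h1
  exact_mod_cast h1

/-! ### Schmidt decompositions and low-rank approximation -/

/-- `ψ = ∑ₖ √(pₖ) ξₖ ⊗ ηₖ` with orthonormal families `ξ` and `η`, over any index type. -/
structure IsSchmidtDecomposition {α β κ : Type*} [Fintype α] [Fintype β] [Fintype κ]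
    (ψ : α × β → ℂ) (p : κ → ℝ) (ξ : κ → EuclideanSpace ℂ α) (η : κ → EuclideanSpace ℂ β) :
    Prop where
  left : Orthonormal ℂ ξ
  right : Orthonormal ℂ η
  eq_sum : ∀ a b, ψ (a, b) = ∑ k, ((√(p k) : ℝ) : ℂ) * ξ k a * η k b

/-- Parseval for the coordinates of an orthonormal family: `∑ₖ ηₖ ⊗ yₖ` has squared norm
`∑ₖ ‖yₖ‖²`. -/
theorem sum_norm_sq_sum_smul {β κ E : Type*} [Fintype β] [Fintype κ] [NormedAddCommGroup E]
    [InnerProductSpace ℂ E] {η : κ → EuclideanSpace ℂ β} (hη : Orthonormal ℂ η) (y : κ → E) :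
    ∑ b, ‖∑ k, η k b • y k‖ ^ 2 = ∑ k, ‖y k‖ ^ 2 := by
  classical
  have h1 : ∀ k l, ∑ b, starRingEnd ℂ (η k b) * η l b = if k = l then 1 else 0 := by
    intro k l
    rw [← orthonormal_iff_ite.mp hη k l, PiLp.inner_apply]
    exact Finset.sum_congr rfl fun b _ => by rw [RCLike.inner_apply, mul_comm]
  have h2 : ∀ v : E, ((‖v‖ ^ 2 : ℝ) : ℂ) = inner ℂ v v := fun v => by
    rw [inner_self_eq_norm_sq_to_K]; norm_cast
  have h3 : ((∑ b, ‖∑ k, η k b • y k‖ ^ 2 : ℝ) : ℂ) = ((∑ k, ‖y k‖ ^ 2 : ℝ) : ℂ) := by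
    simp only [Complex.ofReal_sum, h2, sum_inner, inner_sum, inner_smul_left, inner_smul_right,
      Finset.mul_sum]
    rw [Finset.sum_comm]
    refine Finset.sum_congr rfl fun l _ => ?_
    rw [Finset.sum_comm]
    calc _ = ∑ k, (∑ b, starRingEnd ℂ (η k b) * η l b) * inner ℂ (y k) (y l) := by
          refine Finset.sum_congr rfl fun k _ => ?_
          rw [Finset.sum_mul]
          exact Finset.sum_congr rfl fun b _ => by ring
      _ = _ := by simp [h1]
  exact_mod_cast h3

/-- The squared norm of `∑ₖ dₖ ξₖ ⊗ ηₖ`. -/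
theorem sum_norm_sq_schmidt {α β κ : Type*} [Fintype α] [Fintype β] [Fintype κ]
    {ξ : κ → EuclideanSpace ℂ α} {η : κ → EuclideanSpace ℂ β} (hξ : Orthonormal ℂ ξ)
    (hη : Orthonormal ℂ η) (d : κ → ℂ) :
    ∑ x : α × β, ‖∑ k, d k * ξ k x.1 * η k x.2‖ ^ 2 = ∑ k, ‖d k‖ ^ 2 := by
  have h := sum_norm_sq_sum_smul hη fun k => d k • ξ k
  simp only [norm_smul, hξ.1, mul_one] at h
  rw [← h, Fintype.sum_prod_type, Finset.sum_comm]
  refine Finset.sum_congr rfl fun b _ => ?_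
  rw [EuclideanSpace.norm_sq_eq]
  refine Finset.sum_congr rfl fun a _ => ?_
  simp only [WithLp.ofLp_sum, Finset.sum_apply, PiLp.smul_apply, smul_eq_mul]
  congr 2
  exact Finset.sum_congr rfl fun k _ => by ring

theorem norm_sq_sub_norm_sq_starProjection_le {E : Type*} [NormedAddCommGroup E]
    [InnerProductSpace ℂ E] (W : Submodule ℂ E) [W.HasOrthogonalProjection] (y : E) {x : E}
    (hx : x ∈ W) : ‖y‖ ^ 2 - ‖W.starProjection y‖ ^ 2 ≤ ‖y - x‖ ^ 2 := by
  have h1 := W.norm_sq_eq_add_norm_sq_starProjection y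
  have h2 := W.norm_sq_eq_add_norm_sq_starProjection (y - x)
  have h3 : Wᗮ.starProjection (y - x) = Wᗮ.starProjection y := by
    rw [map_sub, sub_eq_self]
    exact (Submodule.starProjection_apply_eq_zero_iff _).mpr (W.le_orthogonal_orthogonal hx)
  rw [h3] at h2
  nlinarith [sq_nonneg ‖W.starProjection (y - x)‖]

theorem sum_norm_sq_starProjection_le {E ι : Type*} [NormedAddCommGroup E]
    [InnerProductSpace ℂ E] [Fintype ι] (W : Submodule ℂ E) [FiniteDimensional ℂ W]
    {ξ : ι → E} (hξ : Orthonormal ℂ ξ) :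
    ∑ i, ‖W.starProjection (ξ i)‖ ^ 2 ≤ Module.finrank ℂ W := by
  let b := stdOrthonormalBasis ℂ W
  have h1 : ∀ i, ‖W.starProjection (ξ i)‖ ^ 2 = ∑ r, ‖inner ℂ (ξ i) (b r : E)‖ ^ 2 := by
    intro i
    rw [Submodule.starProjection_apply, Submodule.norm_coe, ← b.sum_sq_norm_inner_right]
    refine Finset.sum_congr rfl fun r _ => ?_
    rw [Submodule.inner_orthogonalProjectionOnto_eq_of_mem_left, norm_inner_symm]
  simp only [h1]
  rw [Finset.sum_comm]
  calc _ ≤ ∑ r : Fin (Module.finrank ℂ W), (1 : ℝ) := by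
        refine Finset.sum_le_sum fun r _ => ?_
        refine (hξ.sum_inner_products_le (b r : E)).trans (le_of_eq ?_)
        rw [Submodule.norm_coe, b.orthonormal.1, one_pow]
    _ = _ := by simp

/-- A form of the Eckart–Young theorem. The squared distance from a multiple of a bipartite vector
to an operator `X` is at least the weight that some test of size `rank X` misses. The test is given
by the lengths of the projections of the left Schmidt vectors to the range of `X`. -/
theorem IsSchmidtDecomposition.exists_test {α β ι : Type*} [Fintype α] [Fintype β]
    [Fintype ι] {φ : α × β → ℂ} {p : ι → ℝ} {ξ : ι → EuclideanSpace ℂ α}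
    {η : ι → EuclideanSpace ℂ β} (h : IsSchmidtDecomposition φ p ξ η) (hp : ∀ i, 0 ≤ p i)
    (X : Matrix α β ℂ) :
    ∃ t : ι → ℝ, (∀ i, 0 ≤ t i ∧ t i ≤ 1) ∧ ∑ i, t i ≤ (X.rank : ℝ) ∧
      ∀ c : ℂ, ‖c‖ ^ 2 * (∑ i, p i - ∑ i, t i * p i) ≤
        ∑ x : α × β, ‖c * φ x - X x.1 x.2‖ ^ 2 := by
  classical
  let W : Submodule ℂ (EuclideanSpace ℂ α) := LinearMap.range (Matrix.toLpLin 2 2 X)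
  have hW : Module.finrank ℂ W = X.rank := by
    rw [X.rank_eq_finrank_range_toLin (PiLp.basisFun 2 ℂ α) (PiLp.basisFun 2 ℂ β),
      ← Matrix.toLpLin_eq_toLin]
  refine ⟨fun i => ‖W.starProjection (ξ i)‖ ^ 2, fun i => ⟨by positivity, ?_⟩, ?_, fun c => ?_⟩
  · have h1 := W.norm_starProjection_apply_le (ξ i)
    rw [h.left.1] at h1
    exact pow_le_one₀ (norm_nonneg _) h1
  · rw [← hW]
    exact sum_norm_sq_starProjection_le W h.left
  · let y : β → EuclideanSpace ℂ α := fun b => ∑ k, η k b • ((√(p k) : ℝ) : ℂ) • ξ k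
    let x : β → EuclideanSpace ℂ α := fun b => Matrix.toLpLin 2 2 X (EuclideanSpace.single b 1)
    have h1 : ∑ b, ‖y b‖ ^ 2 = ∑ i, p i := by
      rw [sum_norm_sq_sum_smul h.right]
      refine Finset.sum_congr rfl fun i _ => ?_
      rw [norm_smul, h.left.1, mul_one, Complex.norm_real, Real.norm_eq_abs, sq_abs,
        Real.sq_sqrt (hp i)]
    have h2 : ∑ b, ‖W.starProjection (y b)‖ ^ 2 = ∑ i, ‖W.starProjection (ξ i)‖ ^ 2 * p i := by
      simp only [y, map_sum, map_smul]
      rw [sum_norm_sq_sum_smul h.right]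
      refine Finset.sum_congr rfl fun i _ => ?_
      rw [norm_smul, mul_pow, Complex.norm_real, Real.norm_eq_abs, sq_abs,
        Real.sq_sqrt (hp i), mul_comm]
    rw [← h1, ← h2, ← Finset.sum_sub_distrib, Finset.mul_sum, Fintype.sum_prod_type,
      Finset.sum_comm]
    refine Finset.sum_le_sum fun b _ => ?_
    have h3 := norm_sq_sub_norm_sq_starProjection_le W (c • y b) (x := x b)
      (LinearMap.mem_range_self _ _)
    rw [map_smul, norm_smul, norm_smul, mul_pow, mul_pow, ← mul_sub] at h3
    refine h3.trans (le_of_eq ?_)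
    rw [EuclideanSpace.norm_sq_eq]
    refine Finset.sum_congr rfl fun a _ => ?_
    have h4 : x b a = X a b := by
      simp [x]
    have h5 : y b a = φ (a, b) := by
      rw [h.eq_sum]
      simp only [y, WithLp.ofLp_sum, Finset.sum_apply, PiLp.smul_apply, smul_eq_mul]
      exact Finset.sum_congr rfl fun k _ => by ring
    rw [PiLp.sub_apply, PiLp.smul_apply, h4, h5, smul_eq_mul]

/-- The entanglement monotones of Vidal, in the form needed: a separable operation contracts the
distance to the operators of rank at most `k` on average. Applied to the truncation of the Schmidt
decomposition of `ψ`, this bounds the partial sums of its coefficients. -/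
theorem LOCCTransforms.testDominates {α β α' β' : Type} [Fintype α] [DecidableEq α] [Fintype β]
    [DecidableEq β] [Fintype α'] [DecidableEq α'] [Fintype β'] [DecidableEq β']
    {ι κ : Type*} [Fintype ι] [Fintype κ] {ψ : α × β → ℂ} {φ : α' × β' → ℂ}
    {a : ι → ℝ} {b : κ → ℝ} {ξ : κ → EuclideanSpace ℂ α} {η : κ → EuclideanSpace ℂ β}
    {ξ' : ι → EuclideanSpace ℂ α'} {η' : ι → EuclideanSpace ℂ β'}
    (h : LOCCTransforms ψ φ) (hψ : IsSchmidtDecomposition ψ b ξ η)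
    (hφ : IsSchmidtDecomposition φ a ξ' η') (ha : ∀ i, 0 ≤ a i) (hb : ∀ j, 0 ≤ b j)
    (ha1 : ∑ i, a i = 1) (hb1 : ∑ j, b j = 1) : TestDominates a b := by
  classical
  obtain ⟨E, hE, hout⟩ := h
  obtain ⟨L, _, A, B, hAB, hcomplete⟩ := hE.exists_separable_kraus
  rw [hAB] at hout
  simp only [mul_ketbra_mul_conjTranspose] at hout
  have hφ0 : φ ≠ 0 := by
    rintro rfl
    have h1 := sum_norm_sq_schmidt hφ.left hφ.right fun k => ((√(a k) : ℝ) : ℂ)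
    simp only [← hφ.eq_sum, Pi.zero_apply, norm_zero, Complex.norm_real, Real.norm_eq_abs, sq_abs,
      Real.sq_sqrt (ha _), ha1] at h1
    simp at h1
  obtain ⟨c, hc, hc1⟩ := exists_smul_of_sum_ketbra_eq _ hφ0 hout
  intro S
  let X : α × β → ℂ := fun x =>
    ∑ k, (if k ∈ S then ((√(b k) : ℝ) : ℂ) else 0) * ξ k x.1 * η k x.2
  let M : Matrix α β ℂ := Matrix.of fun a b => X (a, b)
  have hrank : M.rank ≤ S.card := by
    have h1 : M = (Matrix.of fun a k => ξ k a) *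
        (Matrix.diagonal (fun k => if k ∈ S then ((√(b k) : ℝ) : ℂ) else 0) *
          Matrix.of fun k b => η k b) := by
      ext x y
      rw [Matrix.mul_apply]
      simp only [M, X, Matrix.of_apply, Matrix.diagonal_mul]
      exact Finset.sum_congr rfl fun k _ => by ring
    rw [h1]
    refine (Matrix.rank_mul_le_right _ _).trans ((Matrix.rank_mul_le_left _ _).trans ?_)
    rw [Matrix.rank_diagonal, Fintype.card_subtype]
    refine Finset.card_le_card fun k hk => ?_
    by_contra hkS
    simp [hkS] at hk
  have hdist : ∑ x, ‖(ψ - X) x‖ ^ 2 = 1 - ∑ j ∈ S, b j := by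
    have h1 : ∀ x : α × β, (ψ - X) x =
        ∑ k, (if k ∈ S then 0 else ((√(b k) : ℝ) : ℂ)) * ξ k x.1 * η k x.2 := by
      intro x
      rw [Pi.sub_apply, show ψ x = _ from hψ.eq_sum x.1 x.2, ← Finset.sum_sub_distrib]
      refine Finset.sum_congr rfl fun k _ => ?_
      split_ifs <;> ring
    rw [Finset.sum_congr rfl fun x _ => by rw [h1 x], sum_norm_sq_schmidt hψ.left hψ.right,
      ← hb1, ← Finset.sum_filter_add_sum_filter_not Finset.univ (· ∈ S) b,
      Finset.filter_univ_mem, add_sub_cancel_left, Finset.sum_filter]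
    refine Finset.sum_congr rfl fun k _ => ?_
    by_cases hk : k ∈ S <;> simp [hk, Real.sq_sqrt (hb k)]
  choose t ht hcard hle using fun l => hφ.exists_test ha (A l * M * (B l).transpose)
  have hle' : ∑ l, ‖c l‖ ^ 2 * (1 - ∑ i, t l i * a i) ≤ 1 - ∑ j ∈ S, b j := by
    rw [← hdist, ← sum_norm_sq_mulVec hcomplete]
    refine Finset.sum_le_sum fun l _ => ?_
    rw [← ha1]
    refine (hle l (c l)).trans (le_of_eq (Finset.sum_congr rfl fun x _ => ?_))
    rw [Matrix.mulVec_sub, Pi.sub_apply, hc l, kronecker_mulVec_apply]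
    rfl
  refine ⟨fun i => ∑ l, ‖c l‖ ^ 2 * t l i, fun i => ⟨?_, ?_⟩, ?_, ?_⟩
  · exact Finset.sum_nonneg fun l _ => mul_nonneg (by positivity) (ht l i).1
  · rw [← hc1]
    exact Finset.sum_le_sum fun l _ => mul_le_of_le_one_right (by positivity) (ht l i).2
  · rw [Finset.sum_comm]
    calc ∑ l, ∑ i, ‖c l‖ ^ 2 * t l i ≤ ∑ l, ‖c l‖ ^ 2 * S.card := by
          refine Finset.sum_le_sum fun l _ => ?_
          rw [← Finset.mul_sum]
          refine mul_le_mul_of_nonneg_left ((hcard l).trans ?_) (by positivity)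
          have h1 := (Matrix.rank_mul_le_left (A l * M) (B l).transpose).trans
            (Matrix.rank_mul_le_right (A l) M)
          exact_mod_cast h1.trans hrank
      _ = S.card := by rw [← Finset.sum_mul, hc1, one_mul]
  · simp only [mul_sub, mul_one, Finset.sum_sub_distrib, hc1] at hle'
    have h1 : ∑ i, (∑ l, ‖c l‖ ^ 2 * t l i) * a i = ∑ l, ‖c l‖ ^ 2 * ∑ i, t l i * a i := by
      simp only [Finset.sum_mul, Finset.mul_sum]
      rw [Finset.sum_comm]
      exact Finset.sum_congr rfl fun l _ => Finset.sum_congr rfl fun i _ => by ring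
    rw [h1]
    linarith

/-! ### Construction of the protocol of local operations -/

theorem isLOCC_oneWay {α β α' β' : Type} [Fintype α] [DecidableEq α] [Fintype β] [DecidableEq β]
    [Fintype α'] [DecidableEq α'] [Fintype β'] [DecidableEq β'] {L M : Type} [Fintype L]
    [Fintype M] (A : L → Matrix α' α ℂ) (B : L → M → Matrix β' β ℂ)
    (hA : ∑ l, (A l).conjTranspose * A l = 1)
    (hB : ∀ l, ∑ m, (B l m).conjTranspose * B l m = 1) :
    IsLOCC α' β' α β fun ρ => ∑ l, ∑ m, (A l ⊗ₖ B l m) * ρ * (A l ⊗ₖ B l m).conjTranspose := by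
  let e := (Fintype.equivFin L).symm
  let g := (Fintype.equivFin M).symm
  have h := IsLOCC.alice (α' := α') (β' := β') (β := β) (fun _ => α') (fun i => A (e i))
    (by rw [← hA, ← e.sum_comp]) _ fun i =>
      IsLOCC.bob (α := α') (fun _ => β') (fun j => B (e i) (g j))
        (by rw [← hB (e i), ← g.sum_comp]) _ fun _ => IsLOCC.finish
  convert h using 1
  funext ρ
  rw [← e.sum_comp]
  refine Finset.sum_congr rfl fun i _ => ?_
  rw [← g.sum_comp]
  refine Finset.sum_congr rfl fun j _ => ?_
  have hmul : A (e i) ⊗ₖ B (e i) (g j) =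
      ((1 : Matrix α' α' ℂ) ⊗ₖ B (e i) (g j)) * (A (e i) ⊗ₖ (1 : Matrix β β ℂ)) := by
    rw [← Matrix.mul_kronecker_mul, Matrix.mul_one, Matrix.one_mul]
  rw [hmul, Matrix.conjTranspose_mul]
  simp only [Matrix.mul_assoc]

/-- An incomplete family of Kraus operators is completed by measuring in the standard basis on the
rest and preparing a fixed state. -/
theorem sum_conjTranspose_mul_self_elim {α γ L : Type*} [Fintype α] [DecidableEq α] [Fintype γ]
    [DecidableEq γ] [Fintype L] (A : L → Matrix γ α ℂ) (Q : Matrix α α ℂ) (i₀ : γ)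
    (h : ∑ l, (A l).conjTranspose * A l + Q.conjTranspose * Q = 1) :
    ∑ l : L ⊕ α, (Sum.elim A (fun x => Matrix.single i₀ x (1 : ℂ) * Q) l).conjTranspose *
      Sum.elim A (fun x => Matrix.single i₀ x (1 : ℂ) * Q) l = 1 := by
  rw [Fintype.sum_sum_type, ← h]
  simp only [Sum.elim_inl, Sum.elim_inr]
  congr 1
  have h1 : ∀ x : α,
      (Matrix.single i₀ x (1 : ℂ) * Q).conjTranspose * (Matrix.single i₀ x (1 : ℂ) * Q) =
      Q.conjTranspose * (Matrix.single x x 1 * Q) := by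
    intro x
    rw [Matrix.conjTranspose_mul, Matrix.conjTranspose_single, star_one, Matrix.mul_assoc,
      ← Matrix.mul_assoc (Matrix.single x i₀ 1), Matrix.single_mul_single_same, one_mul]
  rw [Finset.sum_congr rfl fun x _ => h1 x, ← Matrix.mul_sum, ← Matrix.sum_mul]
  have h2 : ∑ x : α, Matrix.single x x (1 : ℂ) = 1 := by
    ext y z
    simp [Matrix.sum_apply, Matrix.single_apply, Matrix.one_apply, ite_and]
  rw [h2, Matrix.one_mul]

theorem conjTranspose_mul_self_one_sub {α κ : Type*} [Fintype α] [DecidableEq α] [Fintype κ]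
    [DecidableEq κ] {U : Matrix α κ ℂ} (hU : U.conjTranspose * U = 1) {D : Matrix κ κ ℂ}
    (hD : D.conjTranspose = D) (hDD : D * D = D) :
    (1 - U * D * U.conjTranspose).conjTranspose * (1 - U * D * U.conjTranspose) =
      1 - U * D * U.conjTranspose := by
  have h1 : (U * D * U.conjTranspose).conjTranspose = U * D * U.conjTranspose := by
    simp [Matrix.conjTranspose_mul, hD, Matrix.mul_assoc]
  have h2 : U * D * U.conjTranspose * (U * D * U.conjTranspose) = U * D * U.conjTranspose := by
    calc _ = U * (D * (U.conjTranspose * U) * D) * U.conjTranspose := by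
          simp only [Matrix.mul_assoc]
      _ = _ := by rw [hU, Matrix.mul_one, hDD]
  rw [Matrix.conjTranspose_sub, Matrix.conjTranspose_one, h1, Matrix.mul_sub, Matrix.mul_one,
    Matrix.sub_mul, Matrix.one_mul, h2, sub_self, sub_zero]

theorem Orthonormal.conjTranspose_mul_self {α κ : Type*} [Fintype α] [Fintype κ] [DecidableEq κ]
    {ξ : κ → EuclideanSpace ℂ α} (hξ : Orthonormal ℂ ξ) :
    (Matrix.of fun x k => ξ k x).conjTranspose * (Matrix.of fun x k => ξ k x) = 1 := by
  ext k l
  rw [Matrix.one_apply, ← orthonormal_iff_ite.mp hξ k l, PiLp.inner_apply, Matrix.mul_apply]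
  exact Finset.sum_congr rfl fun x _ => by
    simp [Matrix.conjTranspose_apply, mul_comm]

theorem IsSchmidtDecomposition.of_eq {α β κ : Type*} [Fintype α] [Fintype β] [Fintype κ]
    [DecidableEq κ] {ψ : α × β → ℂ} {p : κ → ℝ} {ξ : κ → EuclideanSpace ℂ α}
    {η : κ → EuclideanSpace ℂ β} (h : IsSchmidtDecomposition ψ p ξ η) :
    (Matrix.of fun x y => ψ (x, y)) = (Matrix.of fun x k => ξ k x) *
      Matrix.diagonal (fun k => ((√(p k) : ℝ) : ℂ)) * (Matrix.of fun y k => η k y).transpose := by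
  ext x y
  rw [Matrix.mul_apply, Matrix.of_apply, h.eq_sum]
  simp only [Matrix.mul_diagonal, Matrix.of_apply, Matrix.transpose_apply]
  exact Finset.sum_congr rfl fun k _ => by ring

/-- The matrices of Nielsen's protocol in the Schmidt bases. Alice applies `C l`, complete on the
support `D` of the source, and Bob applies the partial permutation `R l` with support `G l`. -/
theorem TestDominates.exists_kraus_pair {ι κ : Type*} [Fintype ι] [DecidableEq ι] [Fintype κ]
    [DecidableEq κ] [Nonempty ι] {a : ι → ℝ} {b : κ → ℝ} (h : TestDominates a b)
    (ha : ∀ i, 0 ≤ a i) (hb : ∀ j, 0 ≤ b j) (hsum : ∑ i, a i = ∑ j, b j) :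
    ∃ (L : Type) (_ : Fintype L) (w : L → ℝ) (C R : L → Matrix ι κ ℂ) (D : Matrix κ κ ℂ)
      (G : L → Matrix κ κ ℂ), (∀ l, 0 ≤ w l) ∧ ∑ l, w l = 1 ∧
      (D.conjTranspose = D ∧ D * D = D) ∧
      (∀ l, (G l).conjTranspose = G l ∧ G l * G l = G l ∧ (G l).transpose = G l) ∧
      ∑ l, (C l).conjTranspose * C l = D ∧ (∀ l, (R l).conjTranspose * R l = G l) ∧
      (∀ l, C l * Matrix.diagonal (fun j => ((√(b j) : ℝ) : ℂ)) * (R l).transpose =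
        (√(w l) : ℂ) • Matrix.diagonal fun i => ((√(a i) : ℝ) : ℂ)) ∧
      (∀ l, C l * Matrix.diagonal (fun j => ((√(b j) : ℝ) : ℂ)) * (1 - G l) = 0) ∧
      (1 - D) * Matrix.diagonal (fun j => ((√(b j) : ℝ) : ℂ)) = 0 := by
  classical
  have hsqa : ∀ i, ‖((√(a i) : ℝ) : ℂ)‖ ^ 2 = a i := fun i => by
    rw [Complex.norm_real, Real.norm_eq_abs, sq_abs, Real.sq_sqrt (ha i)]
  have hsqb : ∀ j, ‖((√(b j) : ℝ) : ℂ)‖ ^ 2 = b j := fun j => by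
    rw [Complex.norm_real, Real.norm_eq_abs, sq_abs, Real.sq_sqrt (hb j)]
  obtain ⟨L, _, w, T, f, c, hw, hw1, hf, hcψ, hcT, hcomplete⟩ :=
    TestDominates.exists_kraus (φ := fun i => ((√(a i) : ℝ) : ℂ))
      (ψ := fun j => ((√(b j) : ℝ) : ℂ)) (by simpa only [hsqa, hsqb] using h)
      (by simp only [hsqa, hsqb, hsum])
  let C : L → Matrix ι κ ℂ := fun l => monomialMatrix (c l) (f l)
  let R : L → Matrix ι κ ℂ := fun l => monomialMatrix ((T l).indicator 1) (f l)
  let sb : Matrix κ κ ℂ := Matrix.diagonal fun j => ((√(b j) : ℝ) : ℂ)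
  let sa : Matrix ι ι ℂ := Matrix.diagonal fun i => ((√(a i) : ℝ) : ℂ)
  let D : Matrix κ κ ℂ := Matrix.diagonal fun j => if ((√(b j) : ℝ) : ℂ) = 0 then 0 else 1
  let G : L → Matrix κ κ ℂ := fun l => Matrix.diagonal ((T l).indicator 1)
  have hR : ∀ l, (R l).conjTranspose * R l = G l := by
    intro l
    rw [conjTranspose_monomialMatrix_mul_self ((hf l).injOn.mono fun j =>
      Set.mem_of_indicator_ne_zero)]
    refine congrArg Matrix.diagonal (funext fun j => ?_)
    by_cases hj : j ∈ T l <;> simp [hj]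
  have hCR : ∀ l, C l * sb * (R l).transpose = (√(w l) : ℂ) • sa := by
    intro l
    ext i i'
    have h1 : ∀ j, (C l * sb) i j * (R l).transpose j i' =
        if i = f l j then if i' = f l j then
          (√(w l) : ℂ) * (T l).indicator ((fun i => ((√(a i) : ℝ) : ℂ)) ∘ f l) j else 0 else 0 := by
      intro j
      have h2 := hcψ l j
      simp only [C, R, sb, Matrix.mul_diagonal, monomialMatrix, Matrix.of_apply,
        Matrix.transpose_apply]
      split_ifs
      · rw [h2]
        by_cases hj : j ∈ T l <;> simp [hj]
      · simp
      · simp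
      · simp
    rw [Matrix.mul_apply, Finset.sum_congr rfl fun j _ => h1 j, Matrix.smul_apply, smul_eq_mul]
    by_cases hii : i = i'
    · subst hii
      simp only [sa, Matrix.diagonal_apply_eq]
      rw [← sum_ite_eq_indicator_of_bijOn (hf l) i, Finset.mul_sum]
      refine Finset.sum_congr rfl fun j _ => ?_
      split_ifs <;> simp
    · simp only [sa, Matrix.diagonal_apply_ne _ hii, mul_zero]
      refine Finset.sum_eq_zero fun j _ => ?_
      split_ifs with h1 h2
      · exact absurd (h1.trans h2.symm) hii
      · rfl
      · rfl
  have hCG : ∀ l, C l * sb * (1 - G l) = 0 := by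
    intro l
    rw [show (1 - G l) = Matrix.diagonal (1 - (T l).indicator 1) by
      rw [← Matrix.diagonal_one]; exact Matrix.diagonal_sub _ _]
    ext i j
    simp only [C, sb, Matrix.mul_diagonal, monomialMatrix, Matrix.of_apply]
    by_cases hj : j ∈ T l
    · simp [hj]
    · have : c l j = 0 := by
        by_contra h0
        exact hj (hcT l j h0)
      simp [this]
  have hDsb : (1 - D) * sb = 0 := by
    rw [show (1 - D) = Matrix.diagonal (1 - fun j => if ((√(b j) : ℝ) : ℂ) = 0 then 0 else 1) by
      rw [← Matrix.diagonal_one]; exact Matrix.diagonal_sub _ _]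
    rw [Matrix.diagonal_mul_diagonal]
    ext j k
    by_cases hjk : j = k
    · subst hjk
      by_cases h0 : ((√(b j) : ℝ) : ℂ) = 0
      · rw [Matrix.diagonal_apply_eq, h0, mul_zero, Matrix.zero_apply]
      · simp only [Matrix.diagonal_apply_eq, Pi.sub_apply, Pi.one_apply, if_neg h0, sub_self,
          zero_mul, Matrix.zero_apply]
    · rw [Matrix.diagonal_apply_ne _ hjk, Matrix.zero_apply]
  refine ⟨L, inferInstance, w, C, R, D, G, hw, hw1, ⟨?_, ?_⟩, fun l => ⟨?_, ?_, ?_⟩, hcomplete, hR,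
    hCR, hCG, hDsb⟩
  · rw [Matrix.diagonal_conjTranspose]
    refine congrArg Matrix.diagonal (funext fun j => ?_)
    rw [Pi.star_apply]
    split_ifs <;> simp
  · rw [Matrix.diagonal_mul_diagonal]
    refine congrArg Matrix.diagonal (funext fun j => ?_)
    split_ifs <;> simp
  · rw [Matrix.diagonal_conjTranspose]
    refine congrArg Matrix.diagonal (funext fun j => ?_)
    by_cases hj : j ∈ T l <;> simp [hj]
  · rw [Matrix.diagonal_mul_diagonal]
    refine congrArg Matrix.diagonal (funext fun j => ?_)
    by_cases hj : j ∈ T l <;> simp [hj]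
  · exact Matrix.diagonal_transpose _

/-- Nielsen's protocol. Alice measures in her Schmidt basis with the Kraus operators of
`TestDominates.exists_kraus_pair`, and Bob relabels his Schmidt basis according to the outcome. -/
theorem TestDominates.loccTransforms {α β α' β' : Type} [Fintype α] [DecidableEq α] [Fintype β]
    [DecidableEq β] [Fintype α'] [DecidableEq α'] [Fintype β'] [DecidableEq β']
    {ι κ : Type*} [Fintype ι] [Fintype κ] {ψ : α × β → ℂ} {φ : α' × β' → ℂ}
    {a : ι → ℝ} {b : κ → ℝ} {ξ : κ → EuclideanSpace ℂ α} {η : κ → EuclideanSpace ℂ β}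
    {ξ' : ι → EuclideanSpace ℂ α'} {η' : ι → EuclideanSpace ℂ β'}
    (h : TestDominates a b) (hψ : IsSchmidtDecomposition ψ b ξ η)
    (hφ : IsSchmidtDecomposition φ a ξ' η') (ha : ∀ i, 0 ≤ a i) (hb : ∀ j, 0 ≤ b j)
    (ha1 : ∑ i, a i = 1) (hb1 : ∑ j, b j = 1) : LOCCTransforms ψ φ := by
  classical
  obtain ⟨i⟩ : Nonempty ι := by
    by_contra hempty
    rw [not_nonempty_iff] at hempty
    simp at ha1
  have hne : ∀ {σ : Type} [Fintype σ] {ζ : ι → EuclideanSpace ℂ σ}, Orthonormal ℂ ζ →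
      Nonempty σ := by
    intro σ _ ζ hζ
    by_contra hempty
    rw [not_nonempty_iff] at hempty
    exact hζ.ne_zero i (Subsingleton.elim _ _)
  obtain ⟨x₀⟩ := hne hφ.left
  obtain ⟨y₀⟩ := hne hφ.right
  have hι : Nonempty ι := ⟨i⟩
  obtain ⟨L, _, w, C, R, D, G, hw, hw1, ⟨hD, hDD⟩, hG, hcomplete, hR, hCR, hCG, hDsb⟩ :=
    h.exists_kraus_pair ha hb (ha1.trans hb1.symm)
  set sb : Matrix κ κ ℂ := Matrix.diagonal fun j => ((√(b j) : ℝ) : ℂ)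
  set sa : Matrix ι ι ℂ := Matrix.diagonal fun i => ((√(a i) : ℝ) : ℂ)
  obtain ⟨U, hU, V, hV, hΨ⟩ : ∃ U : Matrix α κ ℂ, U.conjTranspose * U = 1 ∧ ∃ V : Matrix β κ ℂ,
      V.conjTranspose * V = 1 ∧ (Matrix.of fun x y => ψ (x, y)) = U * sb * V.transpose :=
    ⟨_, hψ.left.conjTranspose_mul_self, _, hψ.right.conjTranspose_mul_self, hψ.of_eq⟩
  obtain ⟨U', hU', V', hV', hΦ⟩ : ∃ U' : Matrix α' ι ℂ, U'.conjTranspose * U' = 1 ∧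
      ∃ V' : Matrix β' ι ℂ, V'.conjTranspose * V' = 1 ∧
        (Matrix.of fun x y => φ (x, y)) = U' * sa * V'.transpose :=
    ⟨_, hφ.left.conjTranspose_mul_self, _, hφ.right.conjTranspose_mul_self, hφ.of_eq⟩
  let QA : Matrix α α ℂ := 1 - U * D * U.conjTranspose
  let QB : L → Matrix β β ℂ := fun l => 1 - V * G l * V.conjTranspose
  have hQA : QA * U * sb = 0 := by
    calc QA * U * sb = U * sb - U * D * (U.conjTranspose * U) * sb := by
          simp only [QA, Matrix.sub_mul, Matrix.one_mul, Matrix.mul_assoc]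
      _ = U * ((1 - D) * sb) := by
          rw [hU, Matrix.mul_one, Matrix.sub_mul, Matrix.mul_sub, Matrix.one_mul, Matrix.mul_assoc]
      _ = 0 := by rw [hDsb, Matrix.mul_zero]
  have hQB : ∀ l, V.transpose * (QB l).transpose = (1 - G l) * V.transpose := by
    intro l
    rw [← Matrix.transpose_mul]
    have : QB l * V = V * (1 - G l) := by
      simp only [QB, Matrix.sub_mul, Matrix.mul_sub, Matrix.one_mul, Matrix.mul_one,
        Matrix.mul_assoc, hV]
    rw [this, Matrix.transpose_mul, Matrix.transpose_sub, Matrix.transpose_one,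
      (hG l).2.2]
  let A : L ⊕ α → Matrix α' α ℂ :=
    Sum.elim (fun l => U' * C l * U.conjTranspose) fun x => Matrix.single x₀ x (1 : ℂ) * QA
  let B₁ : L → Unit ⊕ β → Matrix β' β ℂ := fun l =>
    Sum.elim (fun _ => V' * R l * V.conjTranspose) fun y => Matrix.single y₀ y (1 : ℂ) * QB l
  -- After an outcome of Alice that does not occur, Bob just prepares a fixed state.
  let B₂ : Unit ⊕ β → Matrix β' β ℂ :=
    Sum.elim (fun _ => 0) fun y => Matrix.single y₀ y (1 : ℂ) * (1 : Matrix β β ℂ)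
  let B : L ⊕ α → Unit ⊕ β → Matrix β' β ℂ := Sum.elim B₁ fun _ => B₂
  have hA : ∑ l, (A l).conjTranspose * A l = 1 := by
    refine sum_conjTranspose_mul_self_elim _ _ _ ?_
    rw [conjTranspose_mul_self_one_sub hU hD hDD]
    have : ∀ l, (U' * C l * U.conjTranspose).conjTranspose * (U' * C l * U.conjTranspose) =
        U * ((C l).conjTranspose * C l) * U.conjTranspose := by
      intro l
      calc _ = U * (C l).conjTranspose * (U'.conjTranspose * U') * C l * U.conjTranspose := by
            simp only [Matrix.conjTranspose_mul, Matrix.conjTranspose_conjTranspose,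
              Matrix.mul_assoc]
        _ = _ := by rw [hU', Matrix.mul_one]; simp only [Matrix.mul_assoc]
    rw [Finset.sum_congr rfl fun l _ => this l, ← Matrix.sum_mul, ← Matrix.mul_sum, hcomplete,
      add_sub_cancel]
  have hB₁ : ∀ l, ∑ m, (B₁ l m).conjTranspose * B₁ l m = 1 := by
    intro l
    refine sum_conjTranspose_mul_self_elim _ _ _ ?_
    rw [conjTranspose_mul_self_one_sub hV (hG l).1 (hG l).2.1]
    rw [Fintype.sum_unique]
    have : (V' * R l * V.conjTranspose).conjTranspose * (V' * R l * V.conjTranspose) =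
        V * G l * V.conjTranspose := by
      rw [← hR]
      calc _ = V * (R l).conjTranspose * (V'.conjTranspose * V') * R l * V.conjTranspose := by
            simp only [Matrix.conjTranspose_mul, Matrix.conjTranspose_conjTranspose,
              Matrix.mul_assoc]
        _ = _ := by rw [hV', Matrix.mul_one]; simp only [Matrix.mul_assoc]
    rw [this, add_sub_cancel]
  have hB₂ : ∑ m, (B₂ m).conjTranspose * B₂ m = 1 :=
    sum_conjTranspose_mul_self_elim _ _ _ (by simp)
  have hB : ∀ l, ∑ m, (B l m).conjTranspose * B l m = 1 := by
    rintro (l | x)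
    · exact hB₁ l
    · exact hB₂
  refine ⟨_, isLOCC_oneWay A B hA hB, ?_⟩
  simp only [mul_ketbra_mul_conjTranspose]
  have hmain : ∀ l u, (A (.inl l) ⊗ₖ B (.inl l) (.inl u)).mulVec ψ = (√(w l) : ℂ) • φ := by
    intro l u
    have h1 : U' * C l * U.conjTranspose * (U * sb * V.transpose) *
        (V' * R l * V.conjTranspose).transpose = (√(w l) : ℂ) • (U' * sa * V'.transpose) := by
      have h2 : V.transpose * V.conjTranspose.transpose = 1 := by
        rw [← Matrix.transpose_mul, hV, Matrix.transpose_one]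
      calc _ = U' * C l * (U.conjTranspose * U) * sb * (V.transpose * V.conjTranspose.transpose) *
            (R l).transpose * V'.transpose := by
            simp only [Matrix.transpose_mul, Matrix.mul_assoc]
        _ = U' * (C l * sb * (R l).transpose) * V'.transpose := by
            rw [hU, h2, Matrix.mul_one, Matrix.mul_one]
            simp only [Matrix.mul_assoc]
        _ = _ := by rw [hCR, Matrix.mul_smul, Matrix.smul_mul]
    funext x
    rw [kronecker_mulVec_apply, hΨ]
    refine (congrFun (congrFun h1 x.1) x.2).trans ?_
    rw [← hΦ]
    rfl
  have hzero : ∀ (A₁ : Matrix α' α ℂ) (B₁ : Matrix β' β ℂ),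
      A₁ * (U * sb * V.transpose) * B₁.transpose = 0 → (A₁ ⊗ₖ B₁).mulVec ψ = 0 := by
    intro A₁ B₁ h1
    funext x
    rw [kronecker_mulVec_apply, hΨ, h1]
    rfl
  have hrest : ∀ l y, (A (.inl l) ⊗ₖ B (.inl l) (.inr y)).mulVec ψ = 0 := by
    intro l y
    refine hzero _ _ ?_
    calc U' * C l * U.conjTranspose * (U * sb * V.transpose) *
        (Matrix.single y₀ y (1 : ℂ) * QB l).transpose
        = U' * C l * (U.conjTranspose * U) * sb * (V.transpose * (QB l).transpose) *
            (Matrix.single y₀ y (1 : ℂ)).transpose := by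
          simp only [Matrix.transpose_mul, Matrix.mul_assoc]
      _ = U' * (C l * sb * (1 - G l)) * V.transpose *
            (Matrix.single y₀ y (1 : ℂ)).transpose := by
          rw [hU, hQB, Matrix.mul_one]
          simp only [Matrix.mul_assoc]
      _ = 0 := by rw [hCG, Matrix.mul_zero, Matrix.zero_mul, Matrix.zero_mul]
  have hfill : ∀ x m, (A (.inr x) ⊗ₖ B (.inr x) m).mulVec ψ = 0 := by
    intro x m
    refine hzero _ _ ?_
    calc Matrix.single x₀ x (1 : ℂ) * QA * (U * sb * V.transpose) * (B (.inr x) m).transpose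
        = Matrix.single x₀ x (1 : ℂ) * (QA * U * sb) * V.transpose * (B (.inr x) m).transpose := by
          simp only [Matrix.mul_assoc]
      _ = 0 := by rw [hQA, Matrix.mul_zero, Matrix.zero_mul, Matrix.zero_mul]
  have hk0 : ketbra (0 : α' × β' → ℂ) = 0 := by simp [ketbra]
  simp only [Fintype.sum_sum_type, hmain, hrest, hfill, hk0, Finset.sum_const_zero, add_zero,
    Fintype.sum_unique, ketbra_smul, ← Finset.sum_smul]
  have h4 : ∀ l, ‖((√(w l) : ℝ) : ℂ)‖ ^ 2 = w l := fun l => by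
    rw [Complex.norm_real, Real.norm_eq_abs, sq_abs, Real.sq_sqrt (hw l)]
  simp only [h4, ← Complex.ofReal_sum, hw1, Complex.ofReal_one, one_smul]

/-! ### States with a battery attached -/

theorem Orthonormal.prod_fin {σ κ : Type*} [Fintype σ] {ζ : κ → EuclideanSpace ℂ σ}
    (h : Orthonormal ℂ ζ) (N : ℕ) :
    Orthonormal ℂ fun x : κ × Fin N => (WithLp.toLp 2 fun y : σ × Fin N =>
      if y.2 = x.2 then ζ x.1 y.1 else 0 : EuclideanSpace ℂ (σ × Fin N)) := by
  classical
  rw [orthonormal_iff_ite]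
  rintro ⟨k, j⟩ ⟨l, j'⟩
  rw [PiLp.inner_apply, Fintype.sum_prod_type]
  have h1 := orthonormal_iff_ite.mp h k l
  rw [PiLp.inner_apply] at h1
  by_cases hj : j = j'
  · subst hj
    simp only [Prod.mk.injEq, and_true]
    rw [← h1]
    refine Finset.sum_congr rfl fun y _ => ?_
    rw [Finset.sum_eq_single j]
    · simp
    · intro i _ hi
      simp [hi]
    · simp
  · rw [if_neg fun h => hj (Prod.mk.inj h).2]
    refine Finset.sum_eq_zero fun y _ => Finset.sum_eq_zero fun i _ => ?_
    by_cases hi : i = j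
    · simp [hi, hj]
    · simp [hi]

/-- The Schmidt vectors of `ψ ⊗ φ_N` are `ξₖ ⊗ |j⟩` and `ηₖ ⊗ |j⟩`. -/
theorem IsSchmidtDecomposition.bipartiteTensor_maxEntangled {α β κ : Type*} [Fintype α]
    [Fintype β] [Fintype κ] {ψ : α × β → ℂ} {p : κ → ℝ} {ξ : κ → EuclideanSpace ℂ α}
    {η : κ → EuclideanSpace ℂ β} (h : IsSchmidtDecomposition ψ p ξ η) (hp : ∀ k, 0 ≤ p k) (N : ℕ) :
    IsSchmidtDecomposition (bipartiteTensor ψ (maxEntangled N)) (tensorUniform p N)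
      (fun x : κ × Fin N => WithLp.toLp 2 fun y : α × Fin N => if y.2 = x.2 then ξ x.1 y.1 else 0)
      (fun x : κ × Fin N => WithLp.toLp 2 fun y : β × Fin N => if y.2 = x.2 then η x.1 y.1 else 0)
      := by
  refine ⟨h.left.prod_fin N, h.right.prod_fin N, ?_⟩
  rintro ⟨x, c⟩ ⟨y, d⟩
  simp only [bipartiteTensor, maxEntangled]
  rw [h.eq_sum, Fintype.sum_prod_type, Finset.sum_mul]
  refine Finset.sum_congr rfl fun k _ => ?_
  have h1 : √(tensorUniform p N (k, c)) = √(p k) * (1 / √N) := by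
    rw [tensorUniform, Real.sqrt_mul (hp k), Real.sqrt_div zero_le_one, Real.sqrt_one]
  rw [Finset.sum_eq_single c]
  · rw [h1]
    by_cases hcd : c = d
    · subst hcd
      simp only [if_true, Complex.ofReal_mul]
      ring
    · simp [hcd, Ne.symm hcd]
  · intro j _ hj
    simp [hj.symm]
  · simp

theorem loccTransforms_iff_testDominates {α β α' β' : Type} [Fintype α] [DecidableEq α] [Fintype β]
    [DecidableEq β] [Fintype α'] [DecidableEq α'] [Fintype β'] [DecidableEq β']
    {ι κ : Type*} [Fintype ι] [Fintype κ] {ψ : α × β → ℂ} {φ : α' × β' → ℂ}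
    {a : ι → ℝ} {b : κ → ℝ} {ξ : κ → EuclideanSpace ℂ α} {η : κ → EuclideanSpace ℂ β}
    {ξ' : ι → EuclideanSpace ℂ α'} {η' : ι → EuclideanSpace ℂ β'}
    (hψ : IsSchmidtDecomposition ψ b ξ η) (hφ : IsSchmidtDecomposition φ a ξ' η')
    (ha : ∀ i, 0 ≤ a i) (hb : ∀ j, 0 ≤ b j) (ha1 : ∑ i, a i = 1) (hb1 : ∑ j, b j = 1) :
    LOCCTransforms ψ φ ↔ TestDominates a b :=
  ⟨fun h => h.testDominates hψ hφ ha hb ha1 hb1,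
    fun h => h.loccTransforms hψ hφ ha hb ha1 hb1⟩

theorem norm_sq_stateTensor_maxCoherent {ι : Type*} {ψ : ι → ℂ} {p : ι → ℝ}
    (h : ∀ i, ‖ψ i‖ ^ 2 = p i) (N : ℕ) (x : ι × Fin N) :
    ‖stateTensor ψ (maxCoherent N) x‖ ^ 2 = tensorUniform p N x := by
  rw [stateTensor, maxCoherent, tensorUniform, norm_mul, mul_pow, h, Complex.norm_real,
    Real.norm_eq_abs, sq_abs, div_pow, one_pow, Real.sq_sqrt (Nat.cast_nonneg N)]

theorem ofReal_le_natCast_div_natCast_iff {z : ℝ} {N N' : ℕ} (hN' : 0 < N') :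
    ENNReal.ofReal z ≤ (N : ℝ≥0∞) / (N' : ℝ≥0∞) ↔ z ≤ (N : ℝ) / N' := by
  rw [← ENNReal.ofReal_natCast N, ← ENNReal.ofReal_natCast N',
    ← ENNReal.ofReal_div_of_pos (by exact_mod_cast hN'), ENNReal.ofReal_le_ofReal_iff]
  positivity

theorem proposition15 {n m : ℕ} (p : Fin n → ℝ) (q : Fin m → ℝ)
    (hp : p ∈ stdSimplex ℝ (Fin n)) (hq : q ∈ stdSimplex ℝ (Fin m)) :
    ∃ z : ℝ≥0∞, z ≠ 0 ∧ z ≠ ∞ ∧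
      -- `z` is the maximal ratio of the two Lorenz curves
      IsGreatest {r : ℝ≥0∞ | ∃ x : ℝ, x ∈ Set.Ioc (0 : ℝ) 1 ∧
        r = betaCurve x (padSeq p) onesSeq / betaCurve x (padSeq q) onesSeq} z ∧
      -- the cost in terms of majorization
      HasOptimalCost (fun N N' => Majorizes (tensorUniform p N') (tensorUniform q N)) z ∧
      -- the cost for pure bipartite states under LOCC
      (∀ (α β α' β' : Type) [Fintype α] [DecidableEq α] [Fintype β] [DecidableEq β]
          [Fintype α'] [DecidableEq α'] [Fintype β'] [DecidableEq β']
          (ψq : α × β → ℂ) (ψp : α' × β' → ℂ),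
          HasSchmidtCoeffs ψq q → HasSchmidtCoeffs ψp p →
          HasOptimalCost (fun N N' => LOCCTransforms
            (bipartiteTensor ψq (maxEntangled N)) (bipartiteTensor ψp (maxEntangled N'))) z) ∧
      -- the cost for pure coherent states under strictly incoherent operations
      (∀ (ψq : Fin m → ℂ) (ψp : Fin n → ℂ),
          (∀ j, ‖ψq j‖ ^ 2 = q j) → (∀ j, ‖ψp j‖ ^ 2 = p j) →
          HasOptimalCost (fun N N' => SIOTransforms
            (stateTensor ψq (maxCoherent N)) (stateTensor ψp (maxCoherent N'))) z) := by
  obtain ⟨z, hz, hub, S, hSq, hS, hβp, hβq⟩ := exists_max_betaCurve_ratio hp hq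
  have hS1 : ∑ j ∈ S, q j ≤ 1 := by
    rw [← hq.2]
    exact Finset.sum_le_sum_of_subset_of_nonneg (Finset.subset_univ _) fun j _ _ => hq.1 j
  have hcost : ∀ T : ℕ → ℕ → Prop, (∀ N N' : ℕ, 0 < N → 0 < N' →
      (T N N' ↔ TestDominates (tensorUniform p N') (tensorUniform q N))) →
      HasOptimalCost T (ENNReal.ofReal z) := fun T hT =>
    hasOptimalCost_of_iff fun N N' hN hN' => by
      rw [hT N N' hN hN', testDominates_tensorUniform_iff hp hq hz hub hS hβp hN hN',
        ofReal_le_natCast_div_natCast_iff hN']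
  have hsum1 : ∀ {N : ℕ}, 0 < N → ∑ x, tensorUniform p N x = 1 := fun hN =>
    (sum_tensorUniform p hN).trans hp.2
  have hsum2 : ∀ {N : ℕ}, 0 < N → ∑ x, tensorUniform q N x = 1 := fun hN =>
    (sum_tensorUniform q hN).trans hq.2
  refine ⟨ENNReal.ofReal z, by simpa using hz, ENNReal.ofReal_ne_top,
    ⟨⟨∑ j ∈ S, q j, ⟨hSq, hS1⟩, ?_⟩, ?_⟩, hcost _ fun N N' hN hN' => ?_, ?_, ?_⟩
  · rw [hβp, hβq, ENNReal.ofReal_mul hz.le, ENNReal.ofReal_natCast,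
      ENNReal.mul_div_cancel_right (by exact_mod_cast hS.ne') (ENNReal.natCast_ne_top _)]
  · rintro r ⟨x, ⟨hx0, hx1⟩, rfl⟩
    exact ENNReal.div_le_of_le_mul (hub x hx0 hx1)
  · exact majorizes_iff_testDominates (fun x => tensorUniform_nonneg hp.1 _ x)
      ((hsum1 hN').trans (hsum2 hN).symm)
  · rintro α β α' β' _ _ _ _ _ _ _ _ ψq ψp ⟨ξ, η, hξ, hη, hψq⟩ ⟨ξ', η', hξ', hη', hψp⟩
    refine hcost _ fun N N' hN hN' => ?_
    exact loccTransforms_iff_testDominates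
      (IsSchmidtDecomposition.bipartiteTensor_maxEntangled ⟨hξ, hη, hψq⟩ hq.1 N)
      (IsSchmidtDecomposition.bipartiteTensor_maxEntangled ⟨hξ', hη', hψp⟩ hp.1 N')
      (fun x => tensorUniform_nonneg hp.1 _ x) (fun x => tensorUniform_nonneg hq.1 _ x)
      (hsum1 hN') (hsum2 hN)
  · intro ψq ψp hψq hψp
    refine hcost _ fun N N' hN hN' => ?_
    have hnorm1 := norm_sq_stateTensor_maxCoherent hψp N'
    have hnorm2 := norm_sq_stateTensor_maxCoherent hψq N
    have hne : stateTensor ψp (maxCoherent N') ≠ 0 := by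
      intro h0
      have h1 := hsum1 hN'
      simp only [← hnorm1, h0, Pi.zero_apply, norm_zero] at h1
      simp at h1
    obtain ⟨i, -⟩ := Function.ne_iff.mp hne
    have : Nonempty (Fin n × Fin N') := ⟨i⟩
    rw [sioTransforms_iff_testDominates hne (by simp only [hnorm1, hnorm2, hsum1 hN', hsum2 hN])]
    simp only [hnorm1, hnorm2]
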